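/- **Setting.** Let $m\ge 1$, $n,r\ge 0$ be integers and let $G(\lambda)\in\mathbb C(\lambda)^{n\times n}$ be given by a realization $$G(\lambda)=P(\lambda)+C(\lambda E-A)^{-1}B,\qquad P(\lambda)=\sum_{j=0}^m\lambda^jA_j,\quad A_m\ne 0,$$ with $A_j\in\mathbb C^{n\times n}$, $A,E\in\mathbb C^{r\times r}$, $E$ nonsingular, $C\in\mathbb C^{n\times r}$, $B\in\mathbb C^{r\times n}$, which is *minimal*: no realization $P'(\lambda)+C'(\lambda E'-A')^{-1}B'$ of $G(\lambda)$ ($P'(\lambda)$ a matrix polynomial, $E'$ nonsingular) has a pencil $\lambda E'-A'$ of size smaller than $r$. Let $\mathcal S(\lambda)=\begin{bmatrix}P(\lambda)&C\\B&A-\lambda E\end{bmatrix}$ be its system matrix; a system matrix is called *irreducible* if its realization is minimal. **Fiedler matrices.** For $X\in\mathbb C^{n\times n}$ define $mn\times mn$ matrices $M_0(X)=\operatorname{diag}(I_{(m-1)n},X)$, $M_{-m}(X)=\operatorname{diag}(X,I_{(m-1)n})$ and, for $1\le i\le m-1$, $$M_i(X)=\operatorname{diag}\Big(I_{(m-i-1)n},\begin{bmatrix}X&I_n\\I_n&0\end{bmatrix},I_{(i-1)n}\Big),\qquad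 M_{-i}(X)=\operatorname{diag}\Big(I_{(m-i-1)n},\begin{bmatrix}0&I_n\\I_n&X\end{bmatrix},I_{(i-1)n}\Big).$$ Put $\mathbb M_i(X)=\operatorname{diag}(M_i(X),I_r)$ for $-m\le i\le m-1$, $M_i^P=M_i(-A_i)$ for $i\ge 0$, $M_i^P=M_i(A_{-i})$ for $i<0$, and $$\mathbb M_0^{\mathcal S}=\begin{bmatrix}M_0^P&-e_m\otimes C\\-e_m^T\otimes B&-A\end{bmatrix},\quad \mathbb M_{-m}^{\mathcal S}=\begin{bmatrix}M_{-m}^P&0\\0&-E\end{bmatrix},\quad \mathbb M_i^{\mathcal S}=\begin{bmatrix}M_i^P&0\\0&I_r\end{bmatrix},\quad \mathbb M_{-i}^{\mathcal S}=(\mathbb M_i^{\mathcal S})^{-1}\quad(1\le i\le m-1),$$ where $e_m$ is the last column of $I_m$. For an index tuple $\mathbf t=(t_1,\dots,t_k)$ with entries in $\{-m,\dots,m-1\}$ put $\mathbb M_{\mathbf t}^{\mathcal S}=\mathbb M_{t_1}^{\mathcal S}\cdots\mathbb M_{t_k}^{\mathcal S}$, and for a tuple $X=(X_1,\dots,X_k)$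 of $n\times n$ matrices (a *matrix assignment* for $\mathbf t$) put $\mathbb M_{\mathbf t}(X)=\mathbb M_{t_1}(X_1)\cdots\mathbb M_{t_k}(X_k)$. The assignment is *nonsingular* if $X_j$ is nonsingular whenever $t_j\in\{0,-m\}$. A tuple satisfies the *successor infix property* (SIP) if between any two equal entries $i$ there is an entry $i+1$. **GFPRs.** Let $0\le h\le m-1$, let $\sigma$ and $\tau$ be permutations of $\{0,\dots,h\}$ and $\{-m,\dots,-h-1\}$, let $\sigma_1,\sigma_2$ be index tuples with entries in $\{0,\dots,h-1\}$ such that $(\sigma_1,\sigma,\sigma_2)$ satisfies the SIP, and let $\tau_1,\tau_2$ be index tuples with entries in $\{-m,\dots,-h-2\}$ such that $(\tau_1,\tau,\tau_2)$ satisfies the SIP. Let $X_1,X_2,Y_1,Y_2$ be matrix assignments for $\sigma_1,\sigma_2,\tau_1,\tau_2$. The pencil $$\mathbb L(\lambda)=\mathbb M_{\tau_1}(Y_1)\,\mathbb M_{\sigma_1}(X_1)\,(\lambda\mathbb M_\tau^{\mathcal S}-\mathbb M_\sigma^{\mathcal S})\,\mathbb M_{\sigma_2}(X_2)\,\mathbb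 M_{\tau_2}(Y_2)$$ is called a generalized Fiedler pencil with repetition (GFPR) of $G(\lambda)$. **Theorem.** If $X_1,X_2,Y_1,Y_2$ are all nonsingular matrix assignments, then the GFPR $\mathbb L(\lambda)$ is a *Rosenbrock strong linearization* of $G(\lambda)$. That is, $\mathbb L(\lambda)=\begin{bmatrix}\mathcal X-\lambda\mathcal Y&\mathcal C\\\mathcal B&H-\lambda K\end{bmatrix}$ with constant matrices $\mathcal X,\mathcal Y\in\mathbb C^{mn\times mn}$, $\mathcal C\in\mathbb C^{mn\times r}$, $\mathcal B\in\mathbb C^{r\times mn}$, $H,K\in\mathbb C^{r\times r}$, $K$ nonsingular; it is an irreducible system matrix of its transfer function $\mathbb G(\lambda)=\mathcal X-\lambda\mathcal Y+\mathcal C(\lambda K-H)^{-1}\mathcal B$; and (a) there are $mn\times mn$ unimodular matrix polynomials $U(\lambda),V(\lambda)$ (determinant a nonzero constant) and nonsingular $U_0,V_0\in\mathbb C^{r\times r}$ with $$\operatorname{diag}(U(\lambda),U_0)\;\mathbb L(\lambda)\;\operatorname{diag}(V(\lambda),V_0)=\operatorname{diag}(I_{(m-1)n},\mathcal S(\lambda));$$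 (b) there are $mn\times mn$ biproper rational matrices $\mathcal O_\ell(\lambda),\mathcal O_r(\lambda)$ (converging to a nonsingular matrix as $\lambda\to\infty$) with $$\mathcal O_\ell(\lambda)\,\lambda^{-1}\mathbb G(\lambda)\,\mathcal O_r(\lambda)=\operatorname{diag}(I_{(m-1)n},\lambda^{-m}G(\lambda)).$$ -/

import Mathlib

open Polynomial

/-- A realization `P(λ) + C (λ E - A)⁻¹ B` of an `ι × ι` rational matrix over `ℂ`, with matrix
polynomial `P(λ)` and an `r × r` pencil `λ E - A` whose leading coefficient `E` is nonsingular. -/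
structure Realization (ι : Type) (r : ℕ) where
  /-- the polynomial part `P(λ)` -/
  P : Matrix ι ι ℂ[X]
  A : Matrix (Fin r) (Fin r) ℂ
  E : Matrix (Fin r) (Fin r) ℂ
  B : Matrix (Fin r) ι ℂ
  C : Matrix ι (Fin r) ℂ
  det_E_ne_zero : E.det ≠ 0

namespace Realization

/-- The rational matrix `P(λ) + C (λ E - A)⁻¹ B` that is realized (the transfer function).
The matrix `λ E - A` is invertible over `ℂ(λ)`, because `E` is nonsingular. -/
noncomputable def transfer {ι : Type} {r : ℕ} (R : Realization ι r) :
    Matrix ι ι (RatFunc ℂ) :=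
  R.P.map (algebraMap ℂ[X] (RatFunc ℂ)) +
    R.C.map RatFunc.C *
      ((RatFunc.X : RatFunc ℂ) • R.E.map RatFunc.C - R.A.map RatFunc.C)⁻¹ *
      R.B.map RatFunc.C

/-- The Rosenbrock system matrix `[P(λ), C; B, A - λ E]`. -/
noncomputable def systemMatrix {ι : Type} {r : ℕ} (R : Realization ι r) :
    Matrix (ι ⊕ Fin r) (ι ⊕ Fin r) ℂ[X] :=
  Matrix.fromBlocks R.P (R.C.map Polynomial.C) (R.B.map Polynomial.C)
    (R.A.map Polynomial.C - (X : ℂ[X]) • R.E.map Polynomial.C)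

/-- A realization is minimal (its system matrix is irreducible) if the size of its pencil
`λ E - A` is the smallest among all realizations of the same rational matrix. -/
def IsMinimal {ι : Type} {r : ℕ} (R : Realization ι r) : Prop :=
  ∀ (r' : ℕ) (R' : Realization ι r'), R'.transfer = R.transfer → r ≤ r'

/-- The coefficient `A_j` of `λ ^ j` in the polynomial part `P(λ)`. -/
noncomputable def coeff {ι : Type} {r : ℕ} (R : Realization ι r) (j : ℕ) : Matrix ι ι ℂ :=
  R.P.map fun p => p.coeff j

end Realization

/-- A square matrix polynomial is unimodular if its determinant is a nonzero constant. -/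
def IsUnimodular {ι : Type} [Fintype ι] [DecidableEq ι] (U : Matrix ι ι ℂ[X]) : Prop :=
  ∃ c : ℂ, c ≠ 0 ∧ U.det = Polynomial.C c

/-- A square rational matrix `F(λ)` is biproper if `F(λ)` converges, as `λ → ∞` in `ℂ`, to a
nonsingular matrix. -/
def IsBiproper {ι : Type} [Fintype ι] [DecidableEq ι] (F : Matrix ι ι (RatFunc ℂ)) : Prop :=
  ∃ D : Matrix ι ι ℂ, D.det ≠ 0 ∧
    ∀ i j, Filter.Tendsto (fun z : ℂ => (F i j).eval (RingHom.id ℂ) z)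
      (Bornology.cobounded ℂ) (nhds (D i j))

/-- `diag(I_{(m-1)n}, W)`, as an `m × m` block matrix with `n × n` blocks. -/
def diagLast {K : Type} [Zero K] [One K] (m : ℕ) {n : ℕ} (W : Matrix (Fin n) (Fin n) K) :
    Matrix (Fin m × Fin n) (Fin m × Fin n) K :=
  Matrix.comp _ _ _ _ _
    (Matrix.diagonal fun p : Fin m => if (p : ℕ) + 1 = m then W else 1)

/-- `e_m ⊗ C`: the block column with `m` blocks, the last one `C` and the others zero. -/
def lastCol {K : Type} [Zero K] (m : ℕ) {n r : ℕ} (C : Matrix (Fin n) (Fin r) K) :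
    Matrix (Fin m × Fin n) (Fin r) K :=
  Matrix.of fun p k => if (p.1 : ℕ) + 1 = m then C p.2 k else 0

/-- `e_mᵀ ⊗ B`: the block row with `m` blocks, the last one `B` and the others zero. -/
def lastRow {K : Type} [Zero K] (m : ℕ) {n r : ℕ} (B : Matrix (Fin r) (Fin n) K) :
    Matrix (Fin r) (Fin m × Fin n) K :=
  Matrix.of fun k p => if (p.1 : ℕ) + 1 = m then B k p.2 else 0

/-- The matrix `diag(I_{(m-1)n}, 𝒮(λ))`, where `𝒮(λ)` is the system matrix of `R`. -/
noncomputable def Realization.extendedSystemMatrix {n r : ℕ} (R : Realization (Fin n) r) (m : ℕ) :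
    Matrix ((Fin m × Fin n) ⊕ Fin r) ((Fin m × Fin n) ⊕ Fin r) ℂ[X] :=
  Matrix.fromBlocks (diagLast m R.P) (lastCol m (R.C.map Polynomial.C))
    (lastRow m (R.B.map Polynomial.C))
    (R.A.map Polynomial.C - (X : ℂ[X]) • R.E.map Polynomial.C)

/-- `L(λ)` is a Rosenbrock strong linearization of `G(λ) = R.transfer` (with system matrix
`𝒮(λ) = R.systemMatrix` and polynomial part of degree `m`): it is the system matrix
`[𝒳 - λ 𝒴, 𝒞; ℬ, H - λ K]` of a minimal realization `T` whose polynomial part is a pencil, and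
* (a) `diag(U(λ), U₀) L(λ) diag(V(λ), V₀) = diag(I_{(m-1)n}, 𝒮(λ))` for some unimodular
  `U(λ)`, `V(λ)` and nonsingular `U₀`, `V₀`;
* (b) `O_ℓ(λ) λ⁻¹ 𝔾(λ) O_r(λ) = diag(I_{(m-1)n}, λ⁻ᵐ G(λ))` for some biproper `O_ℓ(λ)`, `O_r(λ)`,
  where `𝔾(λ)` is the transfer function of `L(λ)`. -/
def IsRosenbrockStrongLinearization {n r : ℕ} (m : ℕ) (R : Realization (Fin n) r)
    (L : Matrix ((Fin m × Fin n) ⊕ Fin r) ((Fin m × Fin n) ⊕ Fin r) ℂ[X]) : Prop :=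
  ∃ T : Realization (Fin m × Fin n) r,
    (∃ 𝒳 𝒴 : Matrix (Fin m × Fin n) (Fin m × Fin n) ℂ,
      T.P = 𝒳.map Polynomial.C - (X : ℂ[X]) • 𝒴.map Polynomial.C) ∧
    T.systemMatrix = L ∧
    T.IsMinimal ∧
    (∃ (U V : Matrix (Fin m × Fin n) (Fin m × Fin n) ℂ[X]) (U₀ V₀ : Matrix (Fin r) (Fin r) ℂ),
      IsUnimodular U ∧ IsUnimodular V ∧ U₀.det ≠ 0 ∧ V₀.det ≠ 0 ∧
      Matrix.fromBlocks U 0 0 (U₀.map Polynomial.C) * L *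
        Matrix.fromBlocks V 0 0 (V₀.map Polynomial.C) = R.extendedSystemMatrix m) ∧
    (∃ Ol Or : Matrix (Fin m × Fin n) (Fin m × Fin n) (RatFunc ℂ),
      IsBiproper Ol ∧ IsBiproper Or ∧
      Ol * ((RatFunc.X : RatFunc ℂ)⁻¹ • T.transfer) * Or =
        diagLast m (((RatFunc.X : RatFunc ℂ) ^ m)⁻¹ • R.transfer))

/-- The `n × n` blocks of the elementary matrix `M_i(W)`, `-m ≤ i ≤ m - 1`. The block rows and
columns are numbered `0, …, m - 1`, so that the `2 × 2` block pattern of `M_i(W)` and `M_{-i}(W)`,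
`1 ≤ i ≤ m - 1`, sits at the positions `m - i - 1` and `m - i`. -/
def elemBlocks (m : ℕ) {n : ℕ} (i : ℤ) (W : Matrix (Fin n) (Fin n) ℂ) :
    Matrix (Fin m) (Fin m) (Matrix (Fin n) (Fin n) ℂ) :=
  Matrix.of fun p q =>
    if i = 0 then
      if p = q then (if (p : ℤ) + 1 = m then W else 1) else 0
    else if i = -(m : ℤ) then
      if p = q then (if (p : ℤ) = 0 then W else 1) else 0
    else
      -- the upper left, upper right, lower left and lower right corners of the pattern
      if (p : ℤ) + |i| + 1 = m ∧ (q : ℤ) + |i| + 1 = m then (if 0 < i then W else 0)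
      else if (p : ℤ) + |i| + 1 = m ∧ (q : ℤ) + |i| = m then 1
      else if (p : ℤ) + |i| = m ∧ (q : ℤ) + |i| + 1 = m then 1
      else if (p : ℤ) + |i| = m ∧ (q : ℤ) + |i| = m then (if 0 < i then 0 else W)
      else if p = q then 1 else 0

/-- The elementary matrix `M_i(W)` of size `mn × mn`. -/
def elemM (m : ℕ) {n : ℕ} (i : ℤ) (W : Matrix (Fin n) (Fin n) ℂ) :
    Matrix (Fin m × Fin n) (Fin m × Fin n) ℂ :=
  Matrix.comp _ _ _ _ _ (elemBlocks m i W)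

/-- The elementary matrix `𝕄_i(W) = diag(M_i(W), I_r)` of size `(mn + r) × (mn + r)`. -/
def elemMM (m : ℕ) {n : ℕ} (r : ℕ) (i : ℤ) (W : Matrix (Fin n) (Fin n) ℂ) :
    Matrix ((Fin m × Fin n) ⊕ Fin r) ((Fin m × Fin n) ⊕ Fin r) ℂ :=
  Matrix.fromBlocks (elemM m i W) 0 0 1

/-- The product `𝕄_t(W) = 𝕄_{t₁}(W₁) ⋯ 𝕄_{t_k}(W_k)` for an index tuple `t` and a matrix
assignment `W` for `t`. -/
def elemMMTuple (m : ℕ) {n : ℕ} (r : ℕ) (t : List ℤ)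
    (W : Fin t.length → Matrix (Fin n) (Fin n) ℂ) :
    Matrix ((Fin m × Fin n) ⊕ Fin r) ((Fin m × Fin n) ⊕ Fin r) ℂ :=
  (List.ofFn fun j => elemMM m r (t.get j) (W j)).prod

/-- A matrix assignment for `t` is nonsingular if the matrices assigned to the positions occupied
by the indices `0` and `-m` are nonsingular. -/
def IsNonsingularAssignment (m : ℕ) {n : ℕ} (t : List ℤ)
    (W : Fin t.length → Matrix (Fin n) (Fin n) ℂ) : Prop :=
  ∀ j, t.get j = 0 ∨ t.get j = -(m : ℤ) → (W j).det ≠ 0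

namespace Realization

/-- The Fiedler matrix `M_i^P`: `M_i(-A_i)` for `i ≥ 0` and `M_i(A_{-i})` for `i < 0`. -/
noncomputable def fiedlerP {n r : ℕ} (R : Realization (Fin n) r) (m : ℕ) (i : ℤ) :
    Matrix (Fin m × Fin n) (Fin m × Fin n) ℂ :=
  if 0 ≤ i then elemM m i (-R.coeff i.natAbs) else elemM m i (R.coeff i.natAbs)

/-- The Fiedler matrix `𝕄_i^𝒮`, `-m ≤ i ≤ m - 1`, of the system matrix `𝒮(λ)` of `R`. -/
noncomputable def fiedlerS {n r : ℕ} (R : Realization (Fin n) r) (m : ℕ) (i : ℤ) :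
    Matrix ((Fin m × Fin n) ⊕ Fin r) ((Fin m × Fin n) ⊕ Fin r) ℂ :=
  if i = 0 then
    Matrix.fromBlocks (R.fiedlerP m 0) (-lastCol m R.C) (-lastRow m R.B) (-R.A)
  else if i = -(m : ℤ) then
    Matrix.fromBlocks (R.fiedlerP m (-(m : ℤ))) 0 0 (-R.E)
  else if 0 < i then
    Matrix.fromBlocks (R.fiedlerP m i) 0 0 1
  else
    (Matrix.fromBlocks (R.fiedlerP m (-i)) 0 0 1)⁻¹

/-- The product `𝕄_t^𝒮 = 𝕄_{t₁}^𝒮 ⋯ 𝕄_{t_k}^𝒮` for an index tuple `t`. -/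
noncomputable def fiedlerSTuple {n r : ℕ} (R : Realization (Fin n) r) (m : ℕ) (t : List ℤ) :
    Matrix ((Fin m × Fin n) ⊕ Fin r) ((Fin m × Fin n) ⊕ Fin r) ℂ :=
  (t.map (R.fiedlerS m)).prod

/-- The pencil
`𝕄_{τ₁}(Y₁) 𝕄_{σ₁}(X₁) (λ 𝕄_τ^𝒮 - 𝕄_σ^𝒮) 𝕄_{σ₂}(X₂) 𝕄_{τ₂}(Y₂)`. -/
noncomputable def gfprPencil {n r : ℕ} (R : Realization (Fin n) r) (m : ℕ)
    (σ τ σ₁ σ₂ τ₁ τ₂ : List ℤ)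
    (X₁ : Fin σ₁.length → Matrix (Fin n) (Fin n) ℂ)
    (X₂ : Fin σ₂.length → Matrix (Fin n) (Fin n) ℂ)
    (Y₁ : Fin τ₁.length → Matrix (Fin n) (Fin n) ℂ)
    (Y₂ : Fin τ₂.length → Matrix (Fin n) (Fin n) ℂ) :
    Matrix ((Fin m × Fin n) ⊕ Fin r) ((Fin m × Fin n) ⊕ Fin r) ℂ[X] :=
  (elemMMTuple m r τ₁ Y₁).map Polynomial.C * (elemMMTuple m r σ₁ X₁).map Polynomial.C *
    ((X : ℂ[X]) • (R.fiedlerSTuple m τ).map Polynomial.C -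
      (R.fiedlerSTuple m σ).map Polynomial.C) *
    (elemMMTuple m r σ₂ X₂).map Polynomial.C * (elemMMTuple m r τ₂ Y₂).map Polynomial.C

end Realization

/-- The index tuple `t` is a permutation of the set of integers `{a, a + 1, …, b}`. -/
def IsPermutationOf (t : List ℤ) (a b : ℤ) : Prop :=
  t.Nodup ∧ ∀ i : ℤ, i ∈ t ↔ a ≤ i ∧ i ≤ b

/-- The successor infix property: between any two equal entries `i` of the tuple there is an
entry `i + 1`. -/
def SatisfiesSIP (t : List ℤ) : Prop :=
  ∀ a b : Fin t.length, a < b → t.get a = t.get b →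
    ∃ c : Fin t.length, a < c ∧ c < b ∧ t.get c = t.get a + 1

/-! Write σ = (a, 0, b). For 0 < i < m the Fiedler matrices of index i and -i are mutually inverse,
and the outer factors are invertible because the assignments are nonsingular. All these factors act
as the identity on the state space. Pulling them out leaves λ diag(N, -E) - 𝕄₀, where N is the
product of M_{-i}(A_i) over i = 1, …, m in some order (`exists_gfprPencil_eq`).

The rest concerns N as a matrix over the ring of n × n blocks. In α N - diag(1, …, 1, 0) the first
diagonal block is -1 (for m ≥ 2). Eliminating it by a Schur complement gives a pencil of the same
kind with one block fewer, in which A_{m-1} has become A_{m-1} + α A_m. This is a step of Horner's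
rule, and it ends at α A₁ + … + αᵐ Aₘ (`exists_reduction`). The left transformation fixes the last
unit column and the right one the last unit row, so A₀, C and B, which sit in the last block, pass
through unchanged. Over ℂ[λ] with α = λ this is the unimodular equivalence (a).

For (b) the pencil is read backwards. Inverting the factors around M_{-m}(A_m) and reversing the
order of the blocks turns N - α diag(1, …, 1, Z) into a pencil of the first kind, in which Z is the
leading coefficient (`exists_reversed_reduction`). It is used with α = λ⁻¹ over the ring of proper
rational functions, where -Z = A₀ + C(λE - A)⁻¹B is proper because E is nonsingular. Invertible
matrices over this ring are biproper.

Irreducibility follows from (a): the last block of the transformed transfer function is G(λ), and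
multiplying by polynomial matrices costs no extra states (`exists_transfer_eq_mul`). A smaller
realization of the pencil's transfer function would give one of G(λ). -/

/-! ### Bordered block matrices and products of the blocks with negative index. -/

section Blocks

variable {S : Type*} [Ring S]

/-- The matrix `[a, y; x, D]` with a first row and a first column of width one. -/
def bordered {m : ℕ} (a : S) (y x : Fin m → S) (D : Matrix (Fin m) (Fin m) S) :
    Matrix (Fin (m + 1)) (Fin (m + 1)) S :=
  Matrix.of (Fin.cons (Fin.cons a y) fun i => Fin.cons (x i) (D i))

theorem bordered_mul {m : ℕ} (a a' : S) (y x y' x' : Fin m → S)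
    (D D' : Matrix (Fin m) (Fin m) S) :
    bordered a y x D * bordered a' y' x' D' =
      bordered (a * a' + y ⬝ᵥ x') (a • y' + Matrix.vecMul y D')
        (MulOpposite.op a' • x + Matrix.mulVec D x') (Matrix.vecMulVec x y' + D * D') := by
  ext p q
  refine Fin.cases ?_ (fun p => ?_) p <;> refine Fin.cases ?_ (fun q => ?_) q <;>
    simp [bordered, Matrix.mul_apply, Fin.sum_univ_succ, dotProduct, Matrix.vecMul, Matrix.mulVec,
      Matrix.vecMulVec_apply]

theorem one_eq_bordered (m : ℕ) :
    (1 : Matrix (Fin (m + 1)) (Fin (m + 1)) S) = bordered 1 0 0 1 := by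
  ext p q
  refine Fin.cases ?_ (fun p => ?_) p <;> refine Fin.cases ?_ (fun q => ?_) q <;>
    simp [bordered, Matrix.one_apply, Fin.succ_ne_zero, (Fin.succ_ne_zero _).symm]

theorem smul_bordered {K T : Type*} [SMul K T] {m : ℕ} (c : K) (a : T) (y x : Fin m → T)
    (D : Matrix (Fin m) (Fin m) T) :
    c • bordered a y x D = bordered (c • a) (c • y) (c • x) (c • D) := by
  ext p q
  refine Fin.cases ?_ (fun p => ?_) p <;> refine Fin.cases ?_ (fun q => ?_) q <;>
    simp [bordered]

theorem bordered_sub {m : ℕ} (a a' : S) (y x y' x' : Fin m → S) (D D' : Matrix (Fin m) (Fin m) S) :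
    bordered a y x D - bordered a' y' x' D' = bordered (a - a') (y - y') (x - x') (D - D') := by
  ext p q
  refine Fin.cases ?_ (fun p => ?_) p <;> refine Fin.cases ?_ (fun q => ?_) q <;>
    simp [bordered]

theorem isUnit_bordered_diag {m : ℕ} {a : S} {D : Matrix (Fin m) (Fin m) S} (ha : IsUnit a)
    (hD : IsUnit D) : IsUnit (bordered a 0 0 D) := by
  obtain ⟨a, rfl⟩ := ha
  obtain ⟨D, rfl⟩ := hD
  exact ⟨⟨bordered a 0 0 D, bordered ↑a⁻¹ 0 0 ↑D⁻¹,
    by simp [bordered_mul, one_eq_bordered], by simp [bordered_mul, one_eq_bordered]⟩, rfl⟩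

theorem isUnit_bordered_lower {m : ℕ} (x : Fin m → S) : IsUnit (bordered 1 0 x 1) :=
  ⟨⟨bordered 1 0 x 1, bordered 1 0 (-x) 1,
    by simp [bordered_mul, one_eq_bordered], by simp [bordered_mul, one_eq_bordered]⟩, rfl⟩

theorem isUnit_bordered_upper {m : ℕ} (y : Fin m → S) : IsUnit (bordered 1 y 0 1) :=
  ⟨⟨bordered 1 y 0 1, bordered 1 (-y) 0 1,
    by simp [bordered_mul, one_eq_bordered], by simp [bordered_mul, one_eq_bordered]⟩, rfl⟩

theorem single_last_succ (m : ℕ) :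
    (Pi.single (Fin.last (m + 1)) 1 : Fin (m + 2) → S) =
      Fin.cons 0 (Pi.single (Fin.last m) 1) := by
  ext p
  refine Fin.cases ?_ (fun p => ?_) p
  · simp [Fin.ext_iff]
  · simp [Pi.single_apply, ← Fin.succ_last]

theorem bordered_mulVec_cons_zero {m : ℕ} (a : S) (y x v : Fin m → S)
    (D : Matrix (Fin m) (Fin m) S) :
    Matrix.mulVec (bordered a y x D) (Fin.cons 0 v) = Fin.cons (y ⬝ᵥ v) (Matrix.mulVec D v) := by
  ext p
  refine Fin.cases ?_ (fun p => ?_) p <;>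
    simp [bordered, Matrix.mulVec, dotProduct, Fin.sum_univ_succ]

theorem vecMul_cons_zero_bordered {m : ℕ} (a : S) (y x v : Fin m → S)
    (D : Matrix (Fin m) (Fin m) S) :
    Matrix.vecMul (Fin.cons 0 v) (bordered a y x D) = Fin.cons (v ⬝ᵥ x) (Matrix.vecMul v D) := by
  ext p
  refine Fin.cases ?_ (fun p => ?_) p <;>
    simp [bordered, Matrix.vecMul, dotProduct, Fin.sum_univ_succ]

/-- Elimination with pivot -1: adding x times the first row, and y on the column side, clears the
borders, and the Schur complement D - x(-1)⁻¹y has a plus sign. The outer factor -1 normalizes the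
pivot. -/
theorem bordered_schur_complement {m : ℕ} (y x : Fin m → S) (U D V : Matrix (Fin m) (Fin m) S) :
    bordered (-1) 0 0 U * bordered 1 0 x 1 * bordered (-1) y x D *
      (bordered 1 y 0 1 * bordered 1 0 0 V) =
      bordered 1 0 0 (U * (D + Matrix.vecMulVec x y) * V) := by
  simp only [bordered_mul]
  simp [Matrix.mul_add, Matrix.add_mul, Matrix.mul_vecMulVec, Matrix.neg_vecMul, add_comm]

theorem vecMulVec_single_single {ι : Type*} [DecidableEq ι] (i j : ι) (a b : S) :
    Matrix.vecMulVec (Pi.single i a) (Pi.single j b) = Matrix.single i j (a * b) := by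
  ext p q
  simp only [Matrix.single_apply, Matrix.vecMulVec_apply, Pi.single_apply]
  split_ifs <;> first | (exfalso; grind) | simp

/-- The block matrix `diag(1, …, 1, W)` with `m` diagonal blocks. -/
def blockDiagLast (m : ℕ) (W : S) : Matrix (Fin m) (Fin m) S :=
  Matrix.diagonal fun p => if (p : ℕ) + 1 = m then W else 1

theorem blockDiagLast_succ (m : ℕ) (W : S) :
    blockDiagLast (m + 2) W = bordered 1 0 0 (blockDiagLast (m + 1) W) := by
  ext p q
  refine Fin.cases ?_ (fun p => ?_) p <;> refine Fin.cases ?_ (fun q => ?_) q <;>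
    simp [bordered, blockDiagLast, Matrix.diagonal_apply, Fin.succ_ne_zero,
      (Fin.succ_ne_zero _).symm]

theorem blockDiagLast_eq_add (m : ℕ) (W Z : S) :
    blockDiagLast (m + 1) (W + Z) = blockDiagLast (m + 1) W +
      Matrix.single (Fin.last m) (Fin.last m) Z := by
  ext p q
  by_cases hpq : p = q
  · subst hpq
    by_cases hp : p = Fin.last m
    · subst hp; simp [blockDiagLast]
    · have hp' : (p : ℕ) ≠ m := fun h => hp (Fin.ext h)
      simp [blockDiagLast, hp', Ne.symm hp]
  · simp [blockDiagLast, hpq, Matrix.single_apply]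
    grind

/-- The blocks of the elementary matrix with index `-i`, `1 ≤ i ≤ m`, over an arbitrary ring. -/
def negBlock (m i : ℕ) (W : S) : Matrix (Fin m) (Fin m) S :=
  Matrix.of fun p q =>
    if i = m then if p = q then (if (p : ℕ) = 0 then W else 1) else 0
    else
      if (p : ℕ) + i + 1 = m ∧ (q : ℕ) + i + 1 = m then 0
      else if (p : ℕ) + i + 1 = m ∧ (q : ℕ) + i = m then 1
      else if (p : ℕ) + i = m ∧ (q : ℕ) + i + 1 = m then 1
      else if (p : ℕ) + i = m ∧ (q : ℕ) + i = m then W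
      else if p = q then 1 else 0

theorem negBlock_self_succ (m : ℕ) (W : S) :
    negBlock (m + 1) (m + 1) W = bordered W 0 0 1 := by
  ext p q
  refine Fin.cases ?_ (fun p => ?_) p <;> refine Fin.cases ?_ (fun q => ?_) q <;>
    simp [bordered, negBlock, Matrix.one_apply, Fin.succ_ne_zero, (Fin.succ_ne_zero _).symm]

/-- The swap pattern of this index involves the first two blocks. Once the first is stripped, what
remains is the top-index factor of the smaller size with the same parameter, which is why the
induction on size closes. -/
theorem negBlock_succ_pred (m : ℕ) (W : S) :
    negBlock (m + 2) (m + 1) W =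
      bordered 0 (Pi.single 0 1) (Pi.single 0 1) (negBlock (m + 1) (m + 1) W) := by
  ext p q
  refine Fin.cases ?_ (fun p => ?_) p <;> refine Fin.cases ?_ (fun q => ?_) q <;>
  · simp only [bordered, negBlock, Fin.ext_iff, Matrix.of_apply, Fin.cons_succ, Fin.cons_zero,
      Fin.val_succ, Fin.val_zero, Pi.single_apply]
    split_ifs <;> first | rfl | contradiction | omega

theorem negBlock_succ_of_le {m i : ℕ} (hi : i ≤ m) (W : S) :
    negBlock (m + 2) i W = bordered 1 0 0 (negBlock (m + 1) i W) := by
  ext p q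
  refine Fin.cases ?_ (fun p => ?_) p <;> refine Fin.cases ?_ (fun q => ?_) q <;>
  · simp only [bordered, negBlock, Fin.ext_iff, Matrix.of_apply, Fin.cons_succ, Fin.cons_zero,
      Fin.val_succ, Fin.val_zero, Pi.zero_apply]
    split_ifs <;> first | rfl | contradiction | omega

/-- Lets the Schur complement correction be absorbed into the parameter of the top-index factor. -/
theorem negBlock_self_add_single (m : ℕ) (W Z : S) :
    negBlock (m + 1) (m + 1) (W + Z) = negBlock (m + 1) (m + 1) W + Matrix.single 0 0 Z := by
  ext p q
  simp only [negBlock, Matrix.of_apply, Matrix.add_apply, Matrix.single_apply, Fin.ext_iff,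
    Fin.val_zero, if_true]
  split_ifs <;> first | omega | simp

/-- The product of the matrices `negBlock m i (A i)` over the index list `t`. -/
def negProd (m : ℕ) (A : ℕ → S) (t : List ℕ) : Matrix (Fin m) (Fin m) S :=
  (t.map fun i => negBlock m i (A i)).prod

theorem negProd_append (m : ℕ) (A : ℕ → S) (s t : List ℕ) :
    negProd m A (s ++ t) = negProd m A s * negProd m A t := by
  simp [negProd]

theorem negProd_cons (m : ℕ) (A : ℕ → S) (i : ℕ) (t : List ℕ) :
    negProd m A (i :: t) = negBlock m i (A i) * negProd m A t := by
  simp [negProd]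

theorem negProd_congr (m : ℕ) {A A' : ℕ → S} {t : List ℕ} (h : ∀ i ∈ t, A i = A' i) :
    negProd m A t = negProd m A' t := by
  unfold negProd
  congr 1
  exact List.map_congr_left fun i hi => by rw [h i hi]

theorem negProd_lift {m : ℕ} (A : ℕ → S) (t : List ℕ) (ht : ∀ i ∈ t, 1 ≤ i ∧ i ≤ m) :
    negProd (m + 2) A t = bordered 1 0 0 (negProd (m + 1) A t) := by
  induction t with
  | nil => simp [negProd, one_eq_bordered (m + 1)]
  | cons i t ih =>
    rw [negProd_cons, negProd_cons, ih fun j hj => ht j (List.mem_cons_of_mem _ hj),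
      negBlock_succ_of_le (ht i (by simp)).2, bordered_mul]
    simp

/-- Removing the top index `m + 2`: the product is a bordered matrix built from the product for the
remaining indices. -/
theorem negProd_eq_bordered {m : ℕ} (A : ℕ → S) (t : List ℕ) (hn : t.Nodup)
    (ht : ∀ i, i ∈ t ↔ 1 ≤ i ∧ i ≤ m + 2) :
    ∃ (l l' : List ℕ) (a b : S), (l ++ (m + 1) :: l').Nodup ∧
      (∀ i, i ∈ l ++ (m + 1) :: l' ↔ 1 ≤ i ∧ i ≤ m + 1) ∧ a * b = A (m + 2) ∧
      negProd (m + 2) A t =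
        bordered 0 (Matrix.vecMul (Pi.single 0 b) (negProd (m + 1) A l'))
          (Matrix.mulVec (negProd (m + 1) A l) (Pi.single 0 a))
          (negProd (m + 1) A l * negBlock (m + 1) (m + 1) (A (m + 1)) * negProd (m + 1) A l') := by
  obtain ⟨l1, l2, rfl⟩ := List.append_of_mem ((ht (m + 2)).2 (by omega))
  -- Only the factor of index `m + 1` interacts with the top one. If it stands to the left, `A (m +
  -- 2)` lands in the column border; if to the right, in the row border. Hence the factorization `a
  -- * b`.
  have hmem : m + 1 ∈ l1 ∨ m + 1 ∈ l2 := by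
    have := (ht (m + 1)).2 (by omega)
    simpa using this
  rcases hmem with h | h
  · obtain ⟨l3, l4, rfl⟩ := List.append_of_mem h
    have hn' : (l3 ++ (m + 1) :: (l4 ++ l2)).Nodup := by
      refine hn.sublist ?_
      simp
    have hmem' : ∀ i, i ∈ l3 ++ (m + 1) :: (l4 ++ l2) ↔ 1 ≤ i ∧ i ≤ m + 1 := by
      intro i
      have h1 := ht i
      simp only [List.mem_append, List.mem_cons, List.nodup_append, List.nodup_cons] at *
      grind
    have hr : ∀ i, i ∈ l3 ∨ i ∈ l4 ∨ i ∈ l2 → 1 ≤ i ∧ i ≤ m := by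
      intro i hi
      have h1 := hmem' i
      simp only [List.mem_append, List.mem_cons, List.nodup_append, List.nodup_cons] at *
      grind
    refine ⟨l3, l4 ++ l2, A (m + 2), 1, hn', hmem', mul_one _, ?_⟩
    rw [negProd_append, negProd_append, negProd_cons, negProd_cons, negProd_append,
      negProd_lift A l3 (by grind), negProd_lift A l4 (by grind), negProd_lift A l2 (by grind),
      negBlock_succ_pred, negBlock_self_succ (m + 1)]
    simp only [bordered_mul]
    simp [Matrix.mul_assoc]
    rfl
  · obtain ⟨l3, l4, rfl⟩ := List.append_of_mem h
    have hn' : (l1 ++ l3 ++ (m + 1) :: l4).Nodup := by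
      refine hn.sublist ?_
      simp
    have hmem' : ∀ i, i ∈ l1 ++ l3 ++ (m + 1) :: l4 ↔ 1 ≤ i ∧ i ≤ m + 1 := by
      intro i
      have h1 := ht i
      simp only [List.mem_append, List.mem_cons, List.nodup_append, List.nodup_cons] at *
      grind
    have hr : ∀ i, i ∈ l3 ∨ i ∈ l4 ∨ i ∈ l1 → 1 ≤ i ∧ i ≤ m := by
      intro i hi
      have h1 := hmem' i
      simp only [List.mem_append, List.mem_cons, List.nodup_append, List.nodup_cons] at *
      grind
    refine ⟨l1 ++ l3, l4, 1, A (m + 2), hn', hmem', one_mul _, ?_⟩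
    rw [negProd_append, negProd_cons, negProd_append, negProd_cons, negProd_append,
      negProd_lift A l3 (by grind), negProd_lift A l4 (by grind), negProd_lift A l1 (by grind),
      negBlock_succ_pred, negBlock_self_succ (m + 1)]
    simp only [bordered_mul]
    simp [Matrix.mul_assoc]
    rfl

end Blocks

/-! ### Horner reduction of the pencil by successive Schur complements. -/

section Reduction

variable {K S : Type*} [CommRing K] [Ring S] [Algebra K S]

/-- Reduction of the pencil `α T - diag(1, …, 1, 0)` to `diag(1, …, 1, α A₁ + … + αᵐ Aₘ)`. -/
theorem exists_reduction (α : K) (m : ℕ) : ∀ (A : ℕ → S) (t : List ℕ), t.Nodup →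
    (∀ i, i ∈ t ↔ 1 ≤ i ∧ i ≤ m + 1) →
    ∃ U V : Matrix (Fin (m + 1)) (Fin (m + 1)) S, IsUnit U ∧ IsUnit V ∧
      Matrix.mulVec U (Pi.single (Fin.last m) 1) = Pi.single (Fin.last m) 1 ∧
      Matrix.vecMul (Pi.single (Fin.last m) 1) V = Pi.single (Fin.last m) 1 ∧
      U * (α • negProd (m + 1) A t - blockDiagLast (m + 1) 0) * V =
        blockDiagLast (m + 1) (∑ j ∈ Finset.range (m + 1), α ^ (j + 1) • A (j + 1)) := by
  induction m with
  | zero =>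
    intro A t hn ht
    have h1 : t = [1] := by
      apply List.perm_singleton.1
      rw [List.perm_ext_iff_of_nodup hn (by simp)]
      intro i; rw [ht]; simp; omega
    subst h1
    refine ⟨1, 1, isUnit_one, isUnit_one, Matrix.one_mulVec _, Matrix.vecMul_one _, ?_⟩
    ext p q
    have hp := Fin.fin_one_eq_zero p
    have hq := Fin.fin_one_eq_zero q
    subst hp hq
    simp [negProd, negBlock, blockDiagLast]
  | succ m ih =>
    intro A t hn ht
    obtain ⟨l, l', a, b, hn', ht', hab, hprod⟩ := negProd_eq_bordered A t hn ht
    -- Horner step: the eliminated coefficient is folded, with a factor `α`, into the next one.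
    obtain ⟨U, V, hU, hV, hUe, hVe, hUV⟩ :=
      ih (Function.update A (m + 1) (A (m + 1) + α • A (m + 2))) _ hn' ht'
    -- The index `m + 1` occurs only once, so the change of coefficient affects a single factor.
    have hl : ∀ i ∈ l, Function.update A (m + 1) (A (m + 1) + α • A (m + 2)) i = A i := by
      intro i hi
      apply Function.update_of_ne
      rintro rfl
      simp [List.nodup_append, List.nodup_cons] at hn'
      grind
    have hl' : ∀ i ∈ l', Function.update A (m + 1) (A (m + 1) + α • A (m + 2)) i = A i := by
      intro i hi
      apply Function.update_of_ne
      rintro rfl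
      simp [List.nodup_append, List.nodup_cons] at hn'
      grind
    rw [negProd_append, negProd_cons, negProd_congr _ hl, negProd_congr _ hl',
      Function.update_self, negBlock_self_add_single] at hUV
    set Y := negProd (m + 1) A l'
    set X := negProd (m + 1) A l
    set D := negBlock (m + 1) (m + 1) (A (m + 1))
    -- Since `negProd` has corner 0, the pencil has corner -1. Its borders carry the factor `α`, and
    -- so do the elimination vectors.
    refine ⟨bordered (-1) 0 0 U * bordered 1 0 (α • Matrix.mulVec X (Pi.single 0 a)) 1,
      bordered 1 (α • Matrix.vecMul (Pi.single 0 b) Y) 0 1 * bordered 1 0 0 V,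
      (isUnit_bordered_diag isUnit_one.neg hU).mul (isUnit_bordered_lower _),
      (isUnit_bordered_upper _).mul (isUnit_bordered_diag isUnit_one hV), ?_, ?_, ?_⟩
    · rw [← Matrix.mulVec_mulVec, single_last_succ, bordered_mulVec_cons_zero,
        zero_dotProduct, bordered_mulVec_cons_zero, zero_dotProduct, Matrix.one_mulVec, hUe]
    · rw [← Matrix.vecMul_vecMul, single_last_succ, vecMul_cons_zero_bordered,
        dotProduct_zero, vecMul_cons_zero_bordered, dotProduct_zero, Matrix.vecMul_one, hVe]
    · rw [hprod, smul_bordered, blockDiagLast_succ, blockDiagLast_succ, bordered_sub]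
      have hsum : ∑ j ∈ Finset.range (m + 1), α ^ (j + 1) •
          Function.update A (m + 1) (A (m + 1) + α • A (m + 2)) (j + 1) =
          ∑ j ∈ Finset.range (m + 1 + 1), α ^ (j + 1) • A (j + 1) := by
        rw [Finset.sum_range_succ, Finset.sum_range_succ _ (m + 1), Finset.sum_range_succ _ m,
          Function.update_self, smul_add, smul_smul, ← pow_succ, ← add_assoc]
        congr 2
        refine Finset.sum_congr rfl fun j hj => ?_
        rw [Function.update_of_ne]
        have := Finset.mem_range.1 hj
        omega
      rw [← hsum, ← hUV]
      -- Each border supplies one `α`: one is the outer factor of the pencil, the other belongs to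
      -- the increment `α • A (m + 2)`.
      have hxy : Matrix.vecMulVec (α • Matrix.mulVec X (Pi.single 0 a))
          (α • Matrix.vecMul (Pi.single 0 b) Y) =
          α • (X * (Matrix.single 0 0 (α • A (m + 2)) * Y)) := by
        rw [← hab, ← Matrix.smul_single, ← vecMulVec_single_single, Matrix.smul_mul, Matrix.mul_smul,
          Matrix.smul_vecMulVec, Matrix.vecMulVec_smul, Matrix.vecMulVec_mul,
          Matrix.mul_vecMulVec]
      rw [smul_zero, zero_sub, sub_zero, sub_zero, bordered_schur_complement, hxy,
        Matrix.add_mul D, Matrix.mul_add X, smul_add, Matrix.mul_assoc X D Y, add_sub_right_comm]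

end Reduction

/-! ### Block reversal, inverses of the elementary blocks, and the pencil read backwards. -/

section Reversal

variable {S : Type*} [Ring S]

/-- Reversal of the order of the block rows and block columns. -/
def blockRev {T : Type*} {m : ℕ} (M : Matrix (Fin m) (Fin m) T) : Matrix (Fin m) (Fin m) T :=
  M.submatrix Fin.rev Fin.rev

theorem blockRev_mul {m : ℕ} (M N : Matrix (Fin m) (Fin m) S) :
    blockRev (M * N) = blockRev M * blockRev N :=
  (Matrix.submatrix_mul_equiv M N Fin.rev Fin.revPerm Fin.rev).symm

theorem blockRev_one {m : ℕ} : blockRev (1 : Matrix (Fin m) (Fin m) S) = 1 :=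
  Matrix.submatrix_one _ Fin.rev_injective

theorem blockRev_blockRev {T : Type*} {m : ℕ} (M : Matrix (Fin m) (Fin m) T) : blockRev (blockRev M) = M := by
  ext p q
  simp [blockRev]

theorem blockRev_eq_mul {m : ℕ} (M : Matrix (Fin m) (Fin m) S) :
    blockRev M = Fin.revPerm.toPEquiv.toMatrix * M * Fin.revPerm.toPEquiv.toMatrix := by
  rw [PEquiv.toMatrix_toPEquiv_mul, PEquiv.mul_toMatrix_toPEquiv]
  rfl

theorem revPerm_toMatrix_mul_self (m : ℕ) :
    (Fin.revPerm.toPEquiv.toMatrix * Fin.revPerm.toPEquiv.toMatrix : Matrix (Fin m) (Fin m) S) =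
      1 := by
  have h := blockRev_eq_mul (1 : Matrix (Fin m) (Fin m) S)
  rwa [Matrix.mul_one, blockRev_one, eq_comm] at h

theorem isUnit_blockRev {m : ℕ} {M : Matrix (Fin m) (Fin m) S} (h : IsUnit M) : IsUnit (blockRev M) := by
  obtain ⟨u, rfl⟩ := h
  exact ⟨⟨blockRev u, blockRev ↑u⁻¹, by rw [← blockRev_mul, Units.mul_inv, blockRev_one],
    by rw [← blockRev_mul, Units.inv_mul, blockRev_one]⟩, rfl⟩

theorem blockDiagLast_mul (m : ℕ) (W Z : S) :
    blockDiagLast m W * blockDiagLast m Z = blockDiagLast m (W * Z) := by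
  rw [blockDiagLast, blockDiagLast, Matrix.diagonal_mul_diagonal, blockDiagLast]
  congr 1
  ext p
  split_ifs <;> simp

theorem blockDiagLast_one (m : ℕ) : blockDiagLast m (1 : S) = 1 := by
  simp [blockDiagLast]

theorem blockRev_negBlock_self (m : ℕ) (W : S) : blockRev (negBlock m m W) = blockDiagLast m W := by
  ext p q
  simp only [blockRev, negBlock, blockDiagLast, Matrix.submatrix_apply, Matrix.of_apply,
    Matrix.diagonal_apply, Fin.rev_inj, Fin.val_rev, if_true]
  have := p.2
  split_ifs <;> first | rfl | omega

theorem negBlock_eq_sum_single {m i : ℕ} (hi : i < m) (W : S) (a b : Fin m)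
    (ha : (a : ℕ) + i + 1 = m) (hb : (b : ℕ) + i = m) :
    negBlock m i W = 1 - Matrix.single a a 1 - Matrix.single b b 1 + Matrix.single a b 1 +
      Matrix.single b a 1 + Matrix.single b b W := by
  ext p q
  simp only [negBlock, Matrix.of_apply, Matrix.add_apply, Matrix.sub_apply, Matrix.single_apply,
    Matrix.one_apply, Fin.ext_iff]
  split_ifs <;> first | omega | simp

theorem blockRev_negBlock_eq_sum_single {m i : ℕ} (h1 : 1 ≤ i) (W : S) (a b : Fin m)
    (ha : (a : ℕ) + i + 1 = m) (hb : (b : ℕ) + i = m) :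
    blockRev (negBlock m (m - i) W) = 1 - Matrix.single a a 1 - Matrix.single b b 1 +
      Matrix.single a b 1 + Matrix.single b a 1 + Matrix.single a a W := by
  rw [negBlock_eq_sum_single (by omega) W b.rev a.rev (by rw [Fin.val_rev]; omega)
    (by rw [Fin.val_rev]; omega)]
  ext p q
  simp only [blockRev, Matrix.submatrix_apply, Matrix.add_apply, Matrix.sub_apply,
    Matrix.single_apply, Matrix.one_apply, Fin.rev_inj]
  abel

/-- The inverse of [0, 1; 1, W] is [-W, 1; 1, 0], the same pattern with -W upside down; reversing
all blocks moves position i to m - i. No condition on W is needed. -/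
theorem negBlock_mul_blockRev {m i : ℕ} (hi : i < m) (h1 : 1 ≤ i) (W : S) :
    negBlock m i W * blockRev (negBlock m (m - i) (-W)) = 1 := by
  have hab : (⟨m - i - 1, by omega⟩ : Fin m) ≠ ⟨m - i, by omega⟩ := by
    simp only [ne_eq, Fin.mk.injEq]; omega
  rw [negBlock_eq_sum_single hi W ⟨m - i - 1, by omega⟩ ⟨m - i, by omega⟩ (by simp; omega)
    (by simp; omega), blockRev_negBlock_eq_sum_single h1 (-W) ⟨m - i - 1, by omega⟩
    ⟨m - i, by omega⟩ (by simp; omega) (by simp; omega)]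
  generalize (⟨m - i - 1, by omega⟩ : Fin m) = a at *
  generalize (⟨m - i, by omega⟩ : Fin m) = b at *
  simp only [Matrix.mul_add, Matrix.add_mul, Matrix.mul_sub, Matrix.sub_mul,
    Matrix.single_mul_single_same, mul_one, one_mul, ne_eq, hab, hab.symm,
    not_false_eq_true, Matrix.single_mul_single_of_ne]
  simp only [← Matrix.single_neg]
  abel

theorem blockRev_mul_negBlock {m i : ℕ} (hi : i < m) (h1 : 1 ≤ i) (W : S) :
    blockRev (negBlock m (m - i) (-W)) * negBlock m i W = 1 := by
  have h := congrArg blockRev (negBlock_mul_blockRev (m := m) (i := m - i) (by omega) (by omega) (-W))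
  rwa [blockRev_mul, blockRev_blockRev, blockRev_one, neg_neg, Nat.sub_sub_self hi.le] at h

theorem isUnit_negBlock {m i : ℕ} (hi : i < m) (h1 : 1 ≤ i) (W : S) : IsUnit (negBlock m i W) :=
  ⟨⟨_, _, negBlock_mul_blockRev hi h1 W, blockRev_mul_negBlock hi h1 W⟩, rfl⟩

/-- The inverse of a product of elementary blocks is the reversal of a product of the same kind. -/
theorem negProd_mul_blockRev {m : ℕ} (A : ℕ → S) (t : List ℕ) (ht : ∀ i ∈ t, 1 ≤ i ∧ i < m) :
    negProd m A t * blockRev (negProd m (fun i => -A (m - i)) (t.map fun i => m - i).reverse) = 1 ∧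
    blockRev (negProd m (fun i => -A (m - i)) (t.map fun i => m - i).reverse) * negProd m A t = 1 := by
  induction t with
  | nil => simp [negProd, blockRev_one]
  | cons i t ih =>
    obtain ⟨h1, h2⟩ := ht i (by simp)
    obtain ⟨ih1, ih2⟩ := ih fun j hj => ht j (List.mem_cons_of_mem _ hj)
    have hA : A (m - (m - i)) = A i := by rw [Nat.sub_sub_self h2.le]
    have e1 : negProd m (fun i => -A (m - i)) [m - i] = negBlock m (m - i) (-A i) := by
      simp [negProd, hA]
    rw [List.map_cons, List.reverse_cons, negProd_append, blockRev_mul, negProd_cons, e1]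
    constructor
    · rw [mul_assoc, ← mul_assoc (negProd m A t), ih1, one_mul, negBlock_mul_blockRev h2 h1]
    · rw [mul_assoc, ← mul_assoc (blockRev (negBlock _ _ _)), blockRev_mul_negBlock h2 h1, one_mul, ih2]

variable {K : Type*} [CommRing K] [Algebra K S]

theorem blockRev_sub {m : ℕ} (M N : Matrix (Fin m) (Fin m) S) : blockRev (M - N) = blockRev M - blockRev N := rfl

theorem blockRev_smul {m : ℕ} (c : K) (M : Matrix (Fin m) (Fin m) S) : blockRev (c • M) = c • blockRev M := rfl

/-- The term in Z is e Z eᵀ with e the last unit vector, and U e = e, eᵀ V = eᵀ; so it passes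
through the equivalence unchanged. -/
theorem mul_blockDiagLast_mul {m : ℕ} {U V : Matrix (Fin (m + 1)) (Fin (m + 1)) S}
    (hU : Matrix.mulVec U (Pi.single (Fin.last m) 1) = Pi.single (Fin.last m) 1)
    (hV : Matrix.vecMul (Pi.single (Fin.last m) 1) V = Pi.single (Fin.last m) 1)
    (M : Matrix (Fin (m + 1)) (Fin (m + 1)) S) {W : S}
    (h : U * (M - blockDiagLast (m + 1) 0) * V = blockDiagLast (m + 1) W) (Z : S) :
    U * (M - blockDiagLast (m + 1) Z) * V = blockDiagLast (m + 1) (W - Z) := by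
  have hs : Matrix.single (Fin.last m) (Fin.last m) Z =
      Matrix.vecMulVec (Pi.single (Fin.last m) 1) (Z • Pi.single (Fin.last m) (1 : S)) := by
    rw [← Pi.single_smul, vecMulVec_single_single, one_mul, smul_eq_mul, mul_one]
  have hs' : U * Matrix.single (Fin.last m) (Fin.last m) Z * V =
      Matrix.single (Fin.last m) (Fin.last m) Z := by
    rw [hs, Matrix.mul_vecMulVec, Matrix.vecMulVec_mul, hU, Matrix.smul_vecMul, hV]
  have h2 := blockDiagLast_eq_add m (0 : S) Z
  have h3 := blockDiagLast_eq_add m (W - Z) Z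
  rw [zero_add] at h2
  rw [sub_add_cancel] at h3
  rw [h2, ← sub_sub, Matrix.mul_sub, Matrix.sub_mul, h, hs', h3, add_sub_cancel_right]

/-- Reduction of `T - α diag(1, …, 1, Z)`, the pencil read backwards. -/
theorem exists_reversed_reduction (α : K) (m : ℕ) (A : ℕ → S) (Z : S) (t : List ℕ) (hn : t.Nodup)
    (ht : ∀ i, i ∈ t ↔ 1 ≤ i ∧ i ≤ m + 1) :
    ∃ U V : Matrix (Fin (m + 1)) (Fin (m + 1)) S, IsUnit U ∧ IsUnit V ∧
      U * (negProd (m + 1) A t - α • blockDiagLast (m + 1) Z) * V =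
        blockDiagLast (m + 1)
          (∑ j ∈ Finset.range (m + 1), α ^ j • A (m + 1 - j) - α ^ (m + 1) • Z) := by
  obtain ⟨a, b, rfl⟩ := List.append_of_mem ((ht (m + 1)).2 (by omega))
  have hlt : ∀ i, i ∈ a ∨ i ∈ b → 1 ≤ i ∧ i < m + 1 := by
    intro i hi
    have h1 := ht i
    simp only [List.mem_append, List.mem_cons, List.nodup_append, List.nodup_cons] at *
    grind
  set a' := (a.map fun i => m + 1 - i).reverse with ha'
  set b' := (b.map fun i => m + 1 - i).reverse with hb'
  set B : ℕ → S := fun i => -A (m + 1 - i) with hB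
  -- The inverted factors use only indices below `m + 1`. The free top slot receives `Z`, since
  -- `blockDiagLast (m + 1) Z` reversed is the top-index factor with parameter `Z`.
  set B' : ℕ → S := Function.update B (m + 1) Z with hB'
  have hlt' : ∀ i, i ∈ a' ∨ i ∈ b' → 1 ≤ i ∧ i < m + 1 := by
    intro i hi
    simp only [ha', hb', List.mem_reverse, List.mem_map] at hi
    rcases hi with ⟨j, hj, rfl⟩ | ⟨j, hj, rfl⟩
    · have := hlt j (Or.inl hj); omega
    · have := hlt j (Or.inr hj); omega
  have hBa : ∀ l : List ℕ, (∀ i ∈ l, 1 ≤ i ∧ i < m + 1) →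
      negProd (m + 1) B' l = negProd (m + 1) B l := fun l hl =>
    negProd_congr _ fun i hi => Function.update_of_ne (hl i hi).2.ne _ _
  have hn' : (a' ++ (m + 1) :: b').Nodup := by
    have hp : (a' ++ (m + 1) :: b').Perm ((m + 1) :: (a ++ b).map fun i => m + 1 - i) := by
      refine List.perm_middle.trans (List.Perm.cons _ ?_)
      rw [List.map_append]
      exact (List.reverse_perm _).append (List.reverse_perm _)
    rw [hp.nodup_iff, List.nodup_cons]
    have hnn := (List.nodup_cons.1 (List.perm_middle.nodup_iff.1 hn)).2
    constructor
    · intro hmem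
      obtain ⟨j, hj, hj'⟩ := List.mem_map.1 hmem
      have := hlt j (by simpa using hj)
      omega
    · refine List.Nodup.map_on (fun x hx y hy hxy => ?_) hnn
      have := hlt x (by simpa using hx)
      have := hlt y (by simpa using hy)
      omega
  have ht' : ∀ i, i ∈ a' ++ (m + 1) :: b' ↔ 1 ≤ i ∧ i ≤ m + 1 := by
    intro i
    constructor
    · intro hi
      rcases List.mem_append.1 hi with h | h
      · have := hlt' i (Or.inl h); omega
      · rcases List.mem_cons.1 h with h | h
        · omega
        · have := hlt' i (Or.inr h); omega
    · rintro ⟨h1, h2⟩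
      by_cases him : i = m + 1
      · simp [him]
      have hi := (ht (m + 1 - i)).2 (by omega)
      have e : m + 1 - (m + 1 - i) = i := Nat.sub_sub_self h2
      rcases List.mem_append.1 hi with h | h
      · refine List.mem_append_left _ ?_
        exact List.mem_reverse.2 (List.mem_map.2 ⟨_, h, e⟩)
      · rcases List.mem_cons.1 h with h | h
        · omega
        · refine List.mem_append_right _ (List.mem_cons_of_mem _ ?_)
          exact List.mem_reverse.2 (List.mem_map.2 ⟨_, h, e⟩)
  obtain ⟨U, V, hU, hV, hUe, hVe, hUV⟩ := exists_reduction α m B' _ hn' ht'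
  have hUV' := mul_blockDiagLast_mul hUe hVe _ hUV (A (m + 1))
  obtain ⟨ha1, ha2⟩ := negProd_mul_blockRev A a fun i hi => hlt i (Or.inl hi)
  obtain ⟨hb1, hb2⟩ := negProd_mul_blockRev A b fun i hi => hlt i (Or.inr hi)
  rw [negProd_append, negProd_cons, hBa a' fun i hi => hlt' i (Or.inl hi),
    hBa b' fun i hi => hlt' i (Or.inr hi), show B' (m + 1) = Z from Function.update_self _ _ _]
    at hUV'
  -- With the factors on both sides of the top index pulled out, reversal exchanges the two
  -- coefficients: `A (m + 1)` moves to the last block and the inverses join `Z` in a product of the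
  -- original kind.
  have key : negProd (m + 1) A (a ++ (m + 1) :: b) - α • blockDiagLast (m + 1) Z =
      negProd (m + 1) A a * blockRev (-(α • (negProd (m + 1) B a' * (negBlock (m + 1) (m + 1) Z *
        negProd (m + 1) B b')) - blockDiagLast (m + 1) (A (m + 1)))) * negProd (m + 1) A b := by
    rw [neg_sub, blockRev_sub, blockRev_smul, blockRev_mul, blockRev_mul, blockRev_negBlock_self,
      ← blockRev_negBlock_self (m + 1) (A (m + 1)), blockRev_blockRev, Matrix.mul_sub,
      Matrix.sub_mul, Matrix.mul_smul, Matrix.smul_mul, ← Matrix.mul_assoc (negProd (m + 1) A a)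
      (blockRev _), ha1, Matrix.one_mul, Matrix.mul_assoc (blockDiagLast _ _), hb2, Matrix.mul_one,
      negProd_append, negProd_cons, Matrix.mul_assoc]
  set Q := α • (negProd (m + 1) B a' * (negBlock (m + 1) (m + 1) Z * negProd (m + 1) B b')) -
    blockDiagLast (m + 1) (A (m + 1))
  set R : Matrix (Fin (m + 1)) (Fin (m + 1)) S := Fin.revPerm.toPEquiv.toMatrix with hR
  have hRR : R * R = 1 := revPerm_toMatrix_mul_self (m + 1)
  have hRu : IsUnit R := ⟨⟨R, R, hRR, hRR⟩, rfl⟩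
  have hDD : blockDiagLast (m + 1) (-1 : S) * blockDiagLast (m + 1) (-1) = 1 := by
    rw [blockDiagLast_mul, neg_mul_neg, one_mul, blockDiagLast_one]
  have hD : IsUnit (blockDiagLast (m + 1) (-1 : S)) := ⟨⟨_, _, hDD, hDD⟩, rfl⟩
  -- The matrix diag(-1, …, -1, 1) repairs signs: the reversed pencil is -Q, while the reduction of
  -- Q already has ones in the leading blocks.
  refine ⟨-blockDiagLast (m + 1) (-1) * U * R * blockRev (negProd (m + 1) B a'),
    blockRev (negProd (m + 1) B b') * R * V,
    ((hD.neg.mul hU).mul hRu).mul ⟨⟨_, _, ha2, ha1⟩, rfl⟩,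
    (IsUnit.mul ⟨⟨_, _, hb2, hb1⟩, rfl⟩ hRu).mul hV, ?_⟩
  calc _ = -blockDiagLast (m + 1) (-1) * U * R *
        (blockRev (negProd (m + 1) B a') * negProd (m + 1) A a) * blockRev (-Q) *
        (negProd (m + 1) A b * blockRev (negProd (m + 1) B b')) * R * V := by
          rw [key]; simp only [Matrix.mul_assoc]
    _ = blockDiagLast (m + 1) (-1) * (U * ((R * R) * Q * (R * R)) * V) := by
          rw [ha2, hb1, blockRev_eq_mul, ← hR]
          simp only [Matrix.mul_assoc, Matrix.mul_one, Matrix.mul_neg, Matrix.neg_mul, neg_neg]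
    _ = _ := by
          rw [hRR, Matrix.one_mul, Matrix.mul_one, hUV', blockDiagLast_mul]
          congr 1
          rw [neg_one_mul, neg_sub, Finset.sum_range_succ, Finset.sum_range_succ',
            show B' (m + 1) = Z from Function.update_self _ _ _, pow_zero, one_smul, Nat.sub_zero]
          have hs : ∑ j ∈ Finset.range m, α ^ (j + 1) • B' (j + 1) =
              -∑ j ∈ Finset.range m, α ^ (j + 1) • A (m + 1 - (j + 1)) := by
            rw [← Finset.sum_neg_distrib]
            refine Finset.sum_congr rfl fun j hj => ?_
            have := Finset.mem_range.1 hj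
            rw [← smul_neg, show B' (j + 1) = B (j + 1) from
              Function.update_of_ne (by omega) _ _]
          rw [hs]
          abel

end Reversal

/-! ### The ring of proper rational functions and its value at infinity. -/

section ProperRational

open Filter

/-- `RatFunc.eval` respects sums and products away from zeros of denominators; these are finitely
many, so limits at infinity do not see them. -/
theorem eventually_eval_ne_zero {p : ℂ[X]} (hp : p ≠ 0) :
    ∀ᶠ z in Bornology.cobounded ℂ, p.eval₂ (RingHom.id ℂ) z ≠ 0 := by
  have hfin : {z : ℂ | p.IsRoot z}.Finite := Polynomial.finite_setOfPred_isRoot hp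
  filter_upwards [Bornology.isBounded_def.1 hfin.isBounded] with z hz
  simpa using hz

/-- `f(λ)` converges to `d` as `λ → ∞`. -/
def HasLimitAtInfty (f : RatFunc ℂ) (d : ℂ) : Prop :=
  Tendsto (fun z : ℂ => f.eval (RingHom.id ℂ) z) (Bornology.cobounded ℂ) (nhds d)

theorem hasLimitAtInfty_C (c : ℂ) : HasLimitAtInfty (RatFunc.C c) c := by
  simp [HasLimitAtInfty]

theorem HasLimitAtInfty.add {f g : RatFunc ℂ} {c d : ℂ} (hf : HasLimitAtInfty f c)
    (hg : HasLimitAtInfty g d) : HasLimitAtInfty (f + g) (c + d) := by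
  refine (Tendsto.add hf hg).congr' ?_
  filter_upwards [eventually_eval_ne_zero f.denom_ne_zero,
    eventually_eval_ne_zero g.denom_ne_zero] with z h1 h2
  rw [RatFunc.eval_add _ _ h1 h2]

theorem HasLimitAtInfty.mul {f g : RatFunc ℂ} {c d : ℂ} (hf : HasLimitAtInfty f c)
    (hg : HasLimitAtInfty g d) : HasLimitAtInfty (f * g) (c * d) := by
  refine (Tendsto.mul hf hg).congr' ?_
  filter_upwards [eventually_eval_ne_zero f.denom_ne_zero,
    eventually_eval_ne_zero g.denom_ne_zero] with z h1 h2
  rw [RatFunc.eval_mul _ _ h1 h2]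

theorem HasLimitAtInfty.inv {f : RatFunc ℂ} {c : ℂ} (hf : HasLimitAtInfty f c) (hc : c ≠ 0) :
    HasLimitAtInfty f⁻¹ c⁻¹ := by
  have hf0 : f ≠ 0 := by
    rintro rfl
    have h0 : HasLimitAtInfty 0 0 := by simpa using hasLimitAtInfty_C 0
    exact hc (tendsto_nhds_unique hf h0)
  refine (Tendsto.inv₀ hf hc).congr' ?_
  filter_upwards [eventually_eval_ne_zero f.denom_ne_zero,
    eventually_eval_ne_zero f⁻¹.denom_ne_zero] with z h1 h2
  have h3 := RatFunc.eval_mul _ _ h1 h2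
  rw [mul_inv_cancel₀ hf0, RatFunc.eval_one] at h3
  exact inv_eq_of_mul_eq_one_right h3.symm

theorem hasLimitAtInfty_inv_X : HasLimitAtInfty (RatFunc.X : RatFunc ℂ)⁻¹ 0 := by
  refine (tendsto_inv₀_cobounded (α := ℂ)).congr' ?_
  filter_upwards [eventually_eval_ne_zero (RatFunc.X : RatFunc ℂ).denom_ne_zero,
    eventually_eval_ne_zero (RatFunc.X : RatFunc ℂ)⁻¹.denom_ne_zero] with z h1 h2
  have h3 := RatFunc.eval_mul _ _ h1 h2
  rw [mul_inv_cancel₀ RatFunc.X_ne_zero, RatFunc.eval_one, RatFunc.eval_X] at h3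
  exact inv_eq_of_mul_eq_one_right h3.symm

/-- The ring of proper rational functions: those that converge at infinity. -/
def properRing : Subring (RatFunc ℂ) where
  carrier := {f | ∃ d, HasLimitAtInfty f d}
  mul_mem' := by rintro f g ⟨c, hc⟩ ⟨d, hd⟩; exact ⟨_, hc.mul hd⟩
  one_mem' := ⟨1, by simpa using hasLimitAtInfty_C 1⟩
  add_mem' := by rintro f g ⟨c, hc⟩ ⟨d, hd⟩; exact ⟨_, hc.add hd⟩
  zero_mem' := ⟨0, by simpa using hasLimitAtInfty_C 0⟩
  neg_mem' := by
    rintro f ⟨c, hc⟩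
    exact ⟨-1 * c, by simpa using (hasLimitAtInfty_C (-1)).mul hc⟩

/-- The value at infinity of a proper rational function. -/
noncomputable def valueAtInfty : properRing →+* ℂ where
  toFun f := f.2.choose
  map_one' := tendsto_nhds_unique (1 : properRing).2.choose_spec
    (by simp)
  map_mul' f g := tendsto_nhds_unique (f * g).2.choose_spec
    (f.2.choose_spec.mul g.2.choose_spec)
  map_zero' := tendsto_nhds_unique (0 : properRing).2.choose_spec
    (by simp)
  map_add' f g := tendsto_nhds_unique (f + g).2.choose_spec
    (f.2.choose_spec.add g.2.choose_spec)

theorem hasLimitAtInfty_value (f : properRing) : HasLimitAtInfty f (valueAtInfty f) :=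
  f.2.choose_spec

theorem valueAtInfty_eq {f : properRing} {d : ℂ} (h : HasLimitAtInfty f d) : valueAtInfty f = d :=
  tendsto_nhds_unique (hasLimitAtInfty_value f) h

theorem isUnit_of_valueAtInfty_ne_zero {f : properRing} (h : valueAtInfty f ≠ 0) : IsUnit f := by
  have hi := (hasLimitAtInfty_value f).inv h
  have hf0 : (f : RatFunc ℂ) ≠ 0 := by
    intro h0
    have : f = 0 := Subtype.ext h0
    exact h (by rw [this, map_zero])
  exact .of_mul_eq_one ⟨(f : RatFunc ℂ)⁻¹, _, hi⟩ (Subtype.ext (mul_inv_cancel₀ hf0))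

/-- Constants as proper rational functions. -/
noncomputable def properC : ℂ →+* properRing :=
  (RatFunc.C : ℂ →+* RatFunc ℂ).codRestrict properRing fun c => ⟨c, hasLimitAtInfty_C c⟩

theorem coe_properC (c : ℂ) : (properC c : RatFunc ℂ) = RatFunc.C c := rfl

theorem valueAtInfty_properC (c : ℂ) : valueAtInfty (properC c) = c :=
  valueAtInfty_eq (hasLimitAtInfty_C c)

/-- `λ⁻¹` as a proper rational function. -/
noncomputable def properInvX : properRing := ⟨RatFunc.X⁻¹, 0, hasLimitAtInfty_inv_X⟩

theorem valueAtInfty_properInvX : valueAtInfty properInvX = 0 :=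
  valueAtInfty_eq hasLimitAtInfty_inv_X

/-- The value at infinity is a ring homomorphism, so it commutes with the determinant and sends a
unit to a nonzero number. -/
theorem isBiproper_map_of_isUnit {ι : Type} [Fintype ι] [DecidableEq ι]
    {M : Matrix ι ι properRing} (hM : IsUnit M) : IsBiproper (M.map properRing.subtype) := by
  refine ⟨M.map valueAtInfty, ?_, fun i j => hasLimitAtInfty_value (M i j)⟩
  have h := ((Matrix.isUnit_iff_isUnit_det M).1 hM).map valueAtInfty
  rw [RingHom.map_det] at h
  exact h.ne_zero

/-- The resolvent `(λ E - A)⁻¹` is a proper rational matrix. -/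
theorem exists_proper_resolvent {ι : Type} [Fintype ι] [DecidableEq ι] (A E : Matrix ι ι ℂ)
    (hE : E.det ≠ 0) :
    ∃ F : Matrix ι ι properRing,
      ((RatFunc.X : RatFunc ℂ) • E.map RatFunc.C - A.map RatFunc.C) * F.map properRing.subtype =
        1 := by
  -- This is λ⁻¹(λE - A), whose value at infinity is E.
  set G : Matrix ι ι properRing := E.map properC - properInvX • A.map properC with hG
  have hdet : IsUnit G.det := by
    apply isUnit_of_valueAtInfty_ne_zero
    have hGE : valueAtInfty.mapMatrix G = E := by
      ext i j
      simp [hG, valueAtInfty_properC, valueAtInfty_properInvX]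
    rwa [RingHom.map_det, hGE]
  refine ⟨properInvX • G⁻¹, ?_⟩
  have hX : (RatFunc.X : RatFunc ℂ) • E.map RatFunc.C - A.map RatFunc.C =
      (RatFunc.X : RatFunc ℂ) • G.map properRing.subtype := by
    ext i j
    have : (RatFunc.X : RatFunc ℂ) ≠ 0 := RatFunc.X_ne_zero
    simp [hG, coe_properC, properInvX, mul_sub, this]
  have hF : (properInvX • G⁻¹).map properRing.subtype =
      (RatFunc.X : RatFunc ℂ)⁻¹ • (G⁻¹).map properRing.subtype := by
    ext i j
    simp [properInvX]
  rw [hX, hF, Matrix.smul_mul, Matrix.mul_smul, smul_smul, mul_inv_cancel₀ RatFunc.X_ne_zero,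
    one_smul, ← Matrix.map_mul, Matrix.mul_nonsing_inv _ hdet,
    Matrix.map_one _ (map_zero _) (map_one _)]

end ProperRational

/-! ### Division by a regular pencil, and realizations of products with polynomial matrices. -/

section Division

/-- Polynomial division with remainder works because the leading coefficient E of the divisor is
invertible; the divisor has degree one, so the remainder is constant. -/
theorem exists_mul_pencil_add_const {κ ι : Type} [Fintype ι] [DecidableEq ι] [Fintype κ]
    (A E : Matrix ι ι ℂ) (hE : E.det ≠ 0) (M : Matrix κ ι ℂ[X]) :
    ∃ (Q : Matrix κ ι ℂ[X]) (N : Matrix κ ι ℂ),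
      M = Q * ((X : ℂ[X]) • E.map C - A.map C) + N.map C := by
  obtain ⟨d, hd⟩ : ∃ d, ∀ i j, (M i j).natDegree ≤ d :=
    ⟨Finset.univ.sup fun i => Finset.univ.sup fun j => (M i j).natDegree, fun i j =>
      (Finset.le_sup (f := fun j => (M i j).natDegree) (Finset.mem_univ j)).trans
        (Finset.le_sup (f := fun i => Finset.univ.sup fun j => (M i j).natDegree)
          (Finset.mem_univ i))⟩
  induction d generalizing M with
  | zero =>
    refine ⟨0, M.map fun p => p.coeff 0, ?_⟩
    ext1 i j
    simpa using eq_C_of_natDegree_le_zero (hd i j)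
  | succ d ih =>
    obtain ⟨Q, N, hQ⟩ := ih (M.map divX) fun i j => by
      rw [Matrix.map_apply, natDegree_divX_eq_natDegree_tsub_one]
      have := hd i j
      omega
    have hM : M = (X : ℂ[X]) • M.map divX + (M.map fun p => p.coeff 0).map C := by
      ext1 i j
      simp
    have hN : (N * E⁻¹).map C * E.map C = N.map (C : ℂ →+* ℂ[X]) := by
      rw [← Matrix.map_mul, Matrix.mul_assoc, Matrix.nonsing_inv_mul _ (Ne.isUnit hE),
        Matrix.mul_one]
    -- From λN = NE⁻¹(λE - A) + NE⁻¹A.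
    refine ⟨(X : ℂ[X]) • Q + (N * E⁻¹).map C, N * E⁻¹ * A + M.map fun p => p.coeff 0, ?_⟩
    conv_lhs => rw [hM, hQ]
    rw [Matrix.add_mul, Matrix.mul_sub ((N * E⁻¹).map C), Matrix.mul_smul ((N * E⁻¹).map C), hN,
      ← Matrix.map_mul, Matrix.map_add _ (map_add _), Matrix.smul_mul, smul_add]
    abel

theorem exists_pencil_mul_add_const {κ ι : Type} [Fintype ι] [DecidableEq ι] [Fintype κ]
    (A E : Matrix ι ι ℂ) (hE : E.det ≠ 0) (M : Matrix ι κ ℂ[X]) :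
    ∃ (Q : Matrix ι κ ℂ[X]) (N : Matrix ι κ ℂ),
      M = ((X : ℂ[X]) • E.map C - A.map C) * Q + N.map C := by
  obtain ⟨Q, N, h⟩ := exists_mul_pencil_add_const A.transpose E.transpose
    (by rwa [Matrix.det_transpose]) M.transpose
  refine ⟨Q.transpose, N.transpose, ?_⟩
  have h' := congrArg Matrix.transpose h
  rw [Matrix.transpose_transpose, Matrix.transpose_add, Matrix.transpose_mul] at h'
  exact h'

theorem map_pencil {ι : Type} (A E : Matrix ι ι ℂ) :
    ((X : ℂ[X]) • E.map C - A.map C).map (algebraMap ℂ[X] (RatFunc ℂ)) =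
      (RatFunc.X : RatFunc ℂ) • E.map RatFunc.C - A.map RatFunc.C := by
  ext i j
  simp
  ring

theorem map_const {κ ι : Type} (M : Matrix κ ι ℂ) :
    (M.map (C : ℂ →+* ℂ[X])).map (algebraMap ℂ[X] (RatFunc ℂ)) = M.map RatFunc.C := by
  ext i j
  simp

theorem isUnit_det_pencil {ι : Type} [Fintype ι] [DecidableEq ι] (A E : Matrix ι ι ℂ)
    (hE : E.det ≠ 0) :
    IsUnit ((RatFunc.X : RatFunc ℂ) • E.map RatFunc.C - A.map RatFunc.C).det := by
  obtain ⟨F, hF⟩ := exists_proper_resolvent A E hE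
  exact Matrix.isUnit_det_of_right_inverse hF

/-- Multiplying a transfer function by polynomial matrices does not increase the size of the
pencil of a realization. -/
theorem Realization.exists_transfer_eq_mul {ι κ : Type} [Fintype ι] [Fintype κ] {r : ℕ}
    (R : Realization ι r) (M : Matrix κ ι ℂ[X]) (N : Matrix ι κ ℂ[X]) :
    ∃ R' : Realization κ r, R'.transfer =
      M.map (algebraMap ℂ[X] (RatFunc ℂ)) * R.transfer * N.map (algebraMap ℂ[X] (RatFunc ℂ)) := by
  obtain ⟨Q₁, C₁, h₁⟩ := exists_mul_pencil_add_const R.A R.E R.det_E_ne_zero (M * R.C.map Polynomial.C)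
  obtain ⟨Q₂, B₂, h₂⟩ := exists_pencil_mul_add_const R.A R.E R.det_E_ne_zero (R.B.map Polynomial.C * N)
  -- With Λ = λE - A, expand (Q₁Λ + C₁)Λ⁻¹(ΛQ₂ + B₂): all terms but C₁Λ⁻¹B₂ are polynomial, so the
  -- remainders are the new input and output matrices over the same pencil.
  refine ⟨⟨M * R.P * N + Q₁ * ((X : ℂ[X]) • R.E.map Polynomial.C - R.A.map Polynomial.C) * Q₂ + Q₁ * B₂.map Polynomial.C +
    C₁.map Polynomial.C * Q₂, R.A, R.E, B₂, C₁, R.det_E_ne_zero⟩, ?_⟩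
  have h₁' := congrArg (fun M => M.map (algebraMap ℂ[X] (RatFunc ℂ))) h₁
  have h₂' := congrArg (fun M => M.map (algebraMap ℂ[X] (RatFunc ℂ))) h₂
  have hu := isUnit_det_pencil R.A R.E R.det_E_ne_zero
  simp only [Matrix.map_mul, Matrix.map_add _ (map_add (algebraMap ℂ[X] (RatFunc ℂ))), map_pencil,
    map_const] at h₁' h₂'
  simp only [Realization.transfer, Matrix.map_mul,
    Matrix.map_add _ (map_add (algebraMap ℂ[X] (RatFunc ℂ))), map_pencil, map_const]
  set Λ := (RatFunc.X : RatFunc ℂ) • R.E.map RatFunc.C - R.A.map RatFunc.C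
  set M' := M.map (algebraMap ℂ[X] (RatFunc ℂ))
  set N' := N.map (algebraMap ℂ[X] (RatFunc ℂ))
  set q₁ := Q₁.map (algebraMap ℂ[X] (RatFunc ℂ))
  set q₂ := Q₂.map (algebraMap ℂ[X] (RatFunc ℂ))
  have e : M' * (R.C.map RatFunc.C * Λ⁻¹ * R.B.map RatFunc.C) * N' =
      q₁ * Λ * q₂ + q₁ * B₂.map RatFunc.C + C₁.map RatFunc.C * q₂ +
        C₁.map RatFunc.C * Λ⁻¹ * B₂.map RatFunc.C := by
    calc _ = (M' * R.C.map RatFunc.C) * Λ⁻¹ * (R.B.map RatFunc.C * N') := by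
          simp only [Matrix.mul_assoc]
      _ = (q₁ * Λ + C₁.map RatFunc.C) * Λ⁻¹ * (Λ * q₂ + B₂.map RatFunc.C) := by rw [h₁', h₂']
      _ = q₁ * (Λ * Λ⁻¹) * Λ * q₂ + q₁ * (Λ * Λ⁻¹) * B₂.map RatFunc.C +
          (C₁.map RatFunc.C * (Λ⁻¹ * Λ) * q₂ + C₁.map RatFunc.C * Λ⁻¹ * B₂.map RatFunc.C) := by
          simp only [Matrix.mul_add, Matrix.add_mul, Matrix.mul_assoc]
          abel
      _ = _ := by
          rw [Matrix.mul_nonsing_inv _ hu, Matrix.nonsing_inv_mul _ hu, Matrix.mul_one,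
            Matrix.mul_one, add_assoc _ _ (C₁.map RatFunc.C * Λ⁻¹ * _)]
  rw [Matrix.mul_add, Matrix.add_mul, e]
  abel

end Division

/-! ### The elementary matrices expressed through the abstract blocks, and their invertibility. -/

section Elementary

variable {m n : ℕ}

theorem comp_mul {K : Type} [Ring K] (M N : Matrix (Fin m) (Fin m) (Matrix (Fin n) (Fin n) K)) :
    Matrix.comp _ _ _ _ _ (M * N) = Matrix.comp _ _ _ _ _ M * Matrix.comp _ _ _ _ _ N :=
  (Matrix.compRingEquiv (Fin m) (Fin n) K).map_mul M N

theorem elemBlocks_neg {i : ℕ} (h1 : 1 ≤ i) (hi : i ≤ m) (W : Matrix (Fin n) (Fin n) ℂ) :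
    elemBlocks m (-(i : ℤ)) W = negBlock m i W := by
  ext1 p q
  have hpos : ¬(0 : ℤ) < -(i : ℤ) := by omega
  have habs : |(-(i : ℤ))| = i := by rw [abs_neg, Nat.abs_cast]
  simp only [elemBlocks, negBlock, Matrix.of_apply, habs, hpos, if_false, Fin.ext_iff]
  split_ifs <;> first | rfl | omega

theorem elemBlocks_zero (W : Matrix (Fin n) (Fin n) ℂ) :
    elemBlocks m 0 W = blockDiagLast m W := by
  ext1 p q
  simp only [elemBlocks, blockDiagLast, Matrix.of_apply, Matrix.diagonal_apply, if_true]
  split_ifs <;> first | rfl | omega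

/-- Positive indices are reversals of negative ones, so invertibility and inverses need to be
computed only for `negBlock`. -/
theorem elemBlocks_pos {i : ℕ} (h1 : 1 ≤ i) (hi : i < m) (W : Matrix (Fin n) (Fin n) ℂ) :
    elemBlocks m (i : ℤ) W = blockRev (negBlock m (m - i) W) := by
  ext1 p q
  have hp := p.2
  have hq := q.2
  have hpos : (0 : ℤ) < (i : ℤ) := by omega
  have e0 : ¬(i : ℤ) = 0 := by omega
  have e1 : ¬(i : ℤ) = -(m : ℤ) := by omega
  have e2 : ¬m - i = m := by omega
  have c1 : (p : ℤ) + i + 1 = m ↔ m - (p + 1) + (m - i) = m := by omega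
  have c2 : (q : ℤ) + i + 1 = m ↔ m - (q + 1) + (m - i) = m := by omega
  have c3 : (p : ℤ) + i = m ↔ m - (p + 1) + (m - i) + 1 = m := by omega
  have c4 : (q : ℤ) + i = m ↔ m - (q + 1) + (m - i) + 1 = m := by omega
  simp only [elemBlocks, negBlock, blockRev, Matrix.submatrix_apply, Matrix.of_apply,
    Nat.abs_cast, hpos, if_true, e0, e1, e2, if_false, Fin.rev_inj, Fin.val_rev, c1, c2, c3, c4]
  split_ifs <;> first | rfl | omega

theorem isUnit_blockDiagLast {S : Type*} [Ring S] {W : S} (hW : IsUnit W) :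
    IsUnit (blockDiagLast m W) := by
  obtain ⟨u, rfl⟩ := hW
  exact ⟨⟨blockDiagLast m u, blockDiagLast m ↑u⁻¹,
    by rw [blockDiagLast_mul, Units.mul_inv, blockDiagLast_one],
    by rw [blockDiagLast_mul, Units.inv_mul, blockDiagLast_one]⟩, rfl⟩

theorem isUnit_elemM {i : ℤ} (h1 : -(m : ℤ) ≤ i) (h2 : i < m) {W : Matrix (Fin n) (Fin n) ℂ}
    (hW : i = 0 ∨ i = -(m : ℤ) → W.det ≠ 0) : IsUnit (elemM m i W) := by
  have hWu : i = 0 ∨ i = -(m : ℤ) → IsUnit W := fun h =>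
    (Matrix.isUnit_iff_isUnit_det W).2 (hW h).isUnit
  refine (Matrix.isUnit_comp_iff _ _ _).2 ?_
  rcases lt_trichotomy i 0 with hi | rfl | hi
  · obtain ⟨k, rfl⟩ : ∃ k : ℕ, i = -(k : ℤ) := ⟨i.natAbs, by omega⟩
    rw [elemBlocks_neg (by omega) (by omega)]
    by_cases hk : k = m
    · subst hk
      rw [← blockRev_blockRev (negBlock k k W), blockRev_negBlock_self]
      exact isUnit_blockRev (isUnit_blockDiagLast (hWu (Or.inr rfl)))
    · exact isUnit_negBlock (by omega) (by omega) W
  · rw [elemBlocks_zero]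
    exact isUnit_blockDiagLast (hWu (Or.inl rfl))
  · obtain ⟨k, rfl⟩ : ∃ k : ℕ, i = (k : ℤ) := ⟨i.natAbs, by omega⟩
    rw [elemBlocks_pos (by omega) (by omega)]
    exact isUnit_blockRev (isUnit_negBlock (by omega) (by omega) W)

theorem fromBlocks_diag_mul {ι κ K : Type*} [Fintype ι] [Fintype κ] [Ring K]
    (M N : Matrix ι ι K) (D D' : Matrix κ κ K) :
    Matrix.fromBlocks M 0 0 D * Matrix.fromBlocks N 0 0 D' =
      Matrix.fromBlocks (M * N) 0 0 (D * D') := by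
  simp [Matrix.fromBlocks_multiply]

theorem exists_isUnit_elemMMTuple (r : ℕ) (t : List ℤ)
    (ht : ∀ i ∈ t, -(m : ℤ) ≤ i ∧ i < m) (W : Fin t.length → Matrix (Fin n) (Fin n) ℂ)
    (hW : IsNonsingularAssignment m t W) :
    ∃ N, IsUnit N ∧ elemMMTuple m r t W = Matrix.fromBlocks N 0 0 1 := by
  have key : ∀ l : List (Matrix ((Fin m × Fin n) ⊕ Fin r) ((Fin m × Fin n) ⊕ Fin r) ℂ),
      (∀ M ∈ l, ∃ N, IsUnit N ∧ M = Matrix.fromBlocks N 0 0 1) →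
      ∃ N, IsUnit N ∧ l.prod = Matrix.fromBlocks N 0 0 1 := by
    intro l
    induction l with
    | nil => exact fun _ => ⟨1, isUnit_one, by rw [List.prod_nil, Matrix.fromBlocks_one]⟩
    | cons M l ih =>
      intro h
      obtain ⟨N, hN, rfl⟩ := h M (by simp)
      obtain ⟨N', hN', e⟩ := ih fun M hM => h M (List.mem_cons_of_mem _ hM)
      exact ⟨N * N', hN.mul hN', by
        rw [List.prod_cons, e, fromBlocks_diag_mul, Matrix.one_mul]⟩
  refine key _ fun M hM => ?_
  obtain ⟨j, rfl⟩ := (List.mem_ofFn' _ _).1 hM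
  have hj := ht _ (List.get_mem t j)
  exact ⟨_, isUnit_elemM hj.1 hj.2 (hW j), rfl⟩

end Elementary

/-! ### Fiedler products, and the removal of the repetition factors. -/

namespace Realization

variable {m n r : ℕ} (R : Realization (Fin n) r)

/-- The product of the elementary matrices `M_{-i}(A_i)` over the index list `t`. -/
noncomputable def negFiedler (m : ℕ) (t : List ℕ) : Matrix (Fin m × Fin n) (Fin m × Fin n) ℂ :=
  Matrix.comp _ _ _ _ _ (negProd m R.coeff t)

theorem negFiedler_append (s t : List ℕ) :
    R.negFiedler m (s ++ t) = R.negFiedler m s * R.negFiedler m t := by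
  rw [negFiedler, negProd_append, comp_mul, negFiedler, negFiedler]

theorem negFiedler_nil : R.negFiedler m [] = 1 := Matrix.comp_one

theorem negFiedler_singleton (i : ℕ) :
    R.negFiedler m [i] = Matrix.comp _ _ _ _ _ (negBlock m i (R.coeff i)) := by
  simp [negFiedler, negProd]

theorem fiedlerP_mul_negFiedler {i : ℕ} (h1 : 1 ≤ i) (hi : i < m) :
    R.fiedlerP m i * R.negFiedler m [i] = 1 := by
  rw [fiedlerP, if_pos (by omega), elemM, elemBlocks_pos h1 hi, negFiedler_singleton, ← comp_mul,
    Int.natAbs_natCast, blockRev_mul_negBlock hi h1, Matrix.comp_one]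

theorem negFiedler_mul_fiedlerP {i : ℕ} (h1 : 1 ≤ i) (hi : i < m) :
    R.negFiedler m [i] * R.fiedlerP m i = 1 := by
  rw [fiedlerP, if_pos (by omega), elemM, elemBlocks_pos h1 hi, negFiedler_singleton, ← comp_mul,
    Int.natAbs_natCast, negBlock_mul_blockRev hi h1, Matrix.comp_one]

theorem fiedlerS_pos {i : ℕ} (h1 : 1 ≤ i) :
    R.fiedlerS m i = Matrix.fromBlocks (R.fiedlerP m i) 0 0 1 := by
  rw [fiedlerS, if_neg (by omega), if_neg (by omega), if_pos (by omega)]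

theorem fiedlerS_neg {i : ℕ} (h1 : 1 ≤ i) (hi : i < m) :
    R.fiedlerS m (-(i : ℤ)) = Matrix.fromBlocks (R.negFiedler m [i]) 0 0 1 := by
  rw [fiedlerS, if_neg (by omega), if_neg (by omega), if_neg (by omega), neg_neg]
  apply Matrix.inv_eq_right_inv
  rw [fromBlocks_diag_mul, R.fiedlerP_mul_negFiedler h1 hi, Matrix.one_mul, Matrix.fromBlocks_one]

theorem fiedlerS_neg_self (hm : 1 ≤ m) :
    R.fiedlerS m (-(m : ℤ)) = Matrix.fromBlocks (R.negFiedler m [m]) 0 0 (-R.E) := by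
  rw [fiedlerS, if_neg (by omega), if_pos rfl, fiedlerP, if_neg (by omega), elemM,
    elemBlocks_neg hm le_rfl, negFiedler_singleton, Int.natAbs_neg, Int.natAbs_natCast]

theorem fiedlerSTuple_cons (i : ℤ) (t : List ℤ) :
    R.fiedlerSTuple m (i :: t) = R.fiedlerS m i * R.fiedlerSTuple m t := by
  simp [fiedlerSTuple]

theorem fiedlerSTuple_append (s t : List ℤ) :
    R.fiedlerSTuple m (s ++ t) = R.fiedlerSTuple m s * R.fiedlerSTuple m t := by
  simp [fiedlerSTuple]

theorem fiedlerSTuple_of_neg (t : List ℤ) (ht : ∀ i ∈ t, -(m : ℤ) < i ∧ i < 0) :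
    R.fiedlerSTuple m t = Matrix.fromBlocks (R.negFiedler m (t.map Int.natAbs)) 0 0 1 := by
  induction t with
  | nil => simp [fiedlerSTuple, negFiedler_nil]
  | cons i t ih =>
    obtain ⟨h1, h2⟩ := ht i (by simp)
    obtain ⟨k, rfl⟩ : ∃ k : ℕ, i = -(k : ℤ) := ⟨i.natAbs, by omega⟩
    rw [fiedlerSTuple_cons, ih fun j hj => ht j (List.mem_cons_of_mem _ hj),
      R.fiedlerS_neg (by omega) (by omega), fromBlocks_diag_mul, Matrix.one_mul,
      ← negFiedler_append]
    simp

theorem exists_fiedlerSTuple_of_pos (t : List ℤ) (ht : ∀ i ∈ t, 0 < i ∧ i < (m : ℤ)) :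
    ∃ F, R.fiedlerSTuple m t = Matrix.fromBlocks F 0 0 1 ∧
      F * R.negFiedler m (t.map Int.natAbs).reverse = 1 ∧
      R.negFiedler m (t.map Int.natAbs).reverse * F = 1 := by
  induction t with
  | nil => exact ⟨1, by simp [fiedlerSTuple, negFiedler_nil]⟩
  | cons i t ih =>
    obtain ⟨h1, h2⟩ := ht i (by simp)
    obtain ⟨F, hF, hF1, hF2⟩ := ih fun j hj => ht j (List.mem_cons_of_mem _ hj)
    obtain ⟨k, rfl⟩ : ∃ k : ℕ, i = (k : ℤ) := ⟨i.natAbs, by omega⟩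
    refine ⟨R.fiedlerP m k * F, ?_, ?_, ?_⟩
    · rw [fiedlerSTuple_cons, hF, R.fiedlerS_pos (by omega), fromBlocks_diag_mul, Matrix.one_mul]
    · rw [List.map_cons, List.reverse_cons, negFiedler_append, Int.natAbs_natCast,
        Matrix.mul_assoc, ← Matrix.mul_assoc F, hF1, Matrix.one_mul,
        R.fiedlerP_mul_negFiedler (by omega) (by omega)]
    · rw [List.map_cons, List.reverse_cons, negFiedler_append, Int.natAbs_natCast,
        Matrix.mul_assoc, ← Matrix.mul_assoc (R.negFiedler m [k]),
        R.negFiedler_mul_fiedlerP (by omega) (by omega), Matrix.one_mul, hF2]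

/-- Only the factor of index -m touches the state space; by `Nodup` it occurs once, so exactly one
-E survives. -/
theorem fiedlerSTuple_of_mem_neg_self (hm : 1 ≤ m) {t : List ℤ} (hn : t.Nodup)
    (ht : ∀ i ∈ t, -(m : ℤ) ≤ i ∧ i < 0) (hmem : -(m : ℤ) ∈ t) :
    R.fiedlerSTuple m t = Matrix.fromBlocks (R.negFiedler m (t.map Int.natAbs)) 0 0 (-R.E) := by
  obtain ⟨a, b, rfl⟩ := List.append_of_mem hmem
  have hlt : ∀ i, i ∈ a ∨ i ∈ b → -(m : ℤ) < i ∧ i < 0 := by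
    intro i hi
    have h1 := ht i
    simp only [List.mem_append, List.mem_cons, List.nodup_append, List.nodup_cons] at *
    grind
  rw [fiedlerSTuple_append, fiedlerSTuple_cons, R.fiedlerSTuple_of_neg a fun i hi => hlt i (.inl hi),
    R.fiedlerSTuple_of_neg b fun i hi => hlt i (.inr hi), R.fiedlerS_neg_self hm,
    fromBlocks_diag_mul, fromBlocks_diag_mul, ← negFiedler_append, ← negFiedler_append]
  simp

/-- A generalized Fiedler pencil with repetition is equivalent, by constant transformations that
leave the state space alone, to a pencil whose constant coefficient is the index `0` Fiedler
matrix. -/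
theorem exists_gfprPencil_eq (h : ℕ) (hm : h + 1 ≤ m)
    (σ τ σ₁ σ₂ τ₁ τ₂ : List ℤ)
    (hσ : IsPermutationOf σ 0 h) (hτ : IsPermutationOf τ (-m) (-h - 1))
    (hσ₁ : ∀ i ∈ σ₁, 0 ≤ i ∧ i ≤ (h : ℤ) - 1) (hσ₂ : ∀ i ∈ σ₂, 0 ≤ i ∧ i ≤ (h : ℤ) - 1)
    (hτ₁ : ∀ i ∈ τ₁, -(m : ℤ) ≤ i ∧ i ≤ -(h : ℤ) - 2)
    (hτ₂ : ∀ i ∈ τ₂, -(m : ℤ) ≤ i ∧ i ≤ -(h : ℤ) - 2)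
    (X₁ : Fin σ₁.length → Matrix (Fin n) (Fin n) ℂ)
    (X₂ : Fin σ₂.length → Matrix (Fin n) (Fin n) ℂ)
    (Y₁ : Fin τ₁.length → Matrix (Fin n) (Fin n) ℂ)
    (Y₂ : Fin τ₂.length → Matrix (Fin n) (Fin n) ℂ)
    (hX₁ : IsNonsingularAssignment m σ₁ X₁) (hX₂ : IsNonsingularAssignment m σ₂ X₂)
    (hY₁ : IsNonsingularAssignment m τ₁ Y₁) (hY₂ : IsNonsingularAssignment m τ₂ Y₂) :
    ∃ (t : List ℕ) (P Q : Matrix (Fin m × Fin n) (Fin m × Fin n) ℂ),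
      t.Nodup ∧ (∀ i, i ∈ t ↔ 1 ≤ i ∧ i ≤ m) ∧ IsUnit P ∧ IsUnit Q ∧
      R.gfprPencil m σ τ σ₁ σ₂ τ₁ τ₂ X₁ X₂ Y₁ Y₂ =
        (Matrix.fromBlocks P 0 0 1).map Polynomial.C *
          ((X : ℂ[X]) • (Matrix.fromBlocks (R.negFiedler m t) 0 0 (-R.E)).map Polynomial.C -
            (R.fiedlerS m 0).map Polynomial.C) *
          (Matrix.fromBlocks Q 0 0 1).map Polynomial.C := by
  obtain ⟨N₁, hN₁, e₁⟩ := exists_isUnit_elemMMTuple r τ₁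
    (fun i hi => by have := hτ₁ i hi; omega) Y₁ hY₁
  obtain ⟨N₂, hN₂, e₂⟩ := exists_isUnit_elemMMTuple r σ₁
    (fun i hi => by have := hσ₁ i hi; omega) X₁ hX₁
  obtain ⟨N₃, hN₃, e₃⟩ := exists_isUnit_elemMMTuple r σ₂
    (fun i hi => by have := hσ₂ i hi; omega) X₂ hX₂
  obtain ⟨N₄, hN₄, e₄⟩ := exists_isUnit_elemMMTuple r τ₂
    (fun i hi => by have := hτ₂ i hi; omega) Y₂ hY₂
  obtain ⟨hσn, hσm⟩ := hσ
  obtain ⟨hτn, hτm⟩ := hτ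
  obtain ⟨a, b, rfl⟩ := List.append_of_mem ((hσm 0).2 (by omega))
  have hab : ∀ i, (i ∈ a ∨ i ∈ b) ↔ 0 < i ∧ i ≤ (h : ℤ) := by
    intro i
    have h1 := hσm i
    simp only [List.mem_append, List.mem_cons, List.nodup_append, List.nodup_cons] at *
    grind
  obtain ⟨Fa, ha, ha1, ha2⟩ := R.exists_fiedlerSTuple_of_pos (m := m) a
    (fun i hi => by have := (hab i).1 (.inl hi); omega)
  obtain ⟨Fb, hb, hb1, hb2⟩ := R.exists_fiedlerSTuple_of_pos (m := m) b
    (fun i hi => by have := (hab i).1 (.inr hi); omega)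
  have hT := R.fiedlerSTuple_of_mem_neg_self (by omega) hτn
    (fun i hi => by have := (hτm i).1 hi; omega) ((hτm _).2 ⟨le_rfl, by omega⟩)
  have hnab : (a ++ b).Nodup := (List.nodup_cons.1 (List.perm_middle.nodup_iff.1 hσn)).2
  -- Inverting the products over `a` and `b` reverses their order and negates the indices; the
  -- absolute values 1, …, h then complete those of `τ`, which are h + 1, …, m.
  refine ⟨(a.map Int.natAbs).reverse ++ (τ.map Int.natAbs ++ (b.map Int.natAbs).reverse),
    N₁ * N₂ * Fa, Fb * N₃ * N₄, ?_, ?_, (hN₁.mul hN₂).mul ⟨⟨_, _, ha1, ha2⟩, rfl⟩,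
    (IsUnit.mul ⟨⟨_, _, hb1, hb2⟩, rfl⟩ hN₃).mul hN₄, ?_⟩
  · have hp : ((a.map Int.natAbs).reverse ++ (τ.map Int.natAbs ++ (b.map Int.natAbs).reverse)).Perm
        ((a ++ b ++ τ).map Int.natAbs) := by
      rw [List.map_append, List.map_append, List.append_assoc]
      exact (List.reverse_perm _).append
        (List.perm_append_comm.trans ((List.reverse_perm _).append_right _))
    rw [hp.nodup_iff]
    refine List.Nodup.map_on (fun x hx y hy hxy => ?_) ?_
    · have hx' : (x ∈ a ∨ x ∈ b) ∨ x ∈ τ := by simpa [or_assoc] using hx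
      have hy' : (y ∈ a ∨ y ∈ b) ∨ y ∈ τ := by simpa [or_assoc] using hy
      rw [hab, hτm] at hx' hy'
      omega
    · refine List.nodup_append.2 ⟨hnab, hτn, fun x hx y hy hxy => ?_⟩
      have h1 := (hab x).1 (by simpa using hx)
      have h2 := (hτm y).1 hy
      omega
  · intro i
    simp only [List.mem_append, List.mem_reverse, List.mem_map]
    constructor
    · rintro (⟨j, hj, rfl⟩ | ⟨j, hj, rfl⟩ | ⟨j, hj, rfl⟩)
      · have := (hab j).1 (.inl hj); omega
      · have := (hτm j).1 hj; omega
      · have := (hab j).1 (.inr hj); omega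
    · rintro ⟨h1, h2⟩
      by_cases hi : i ≤ h
      · rcases (hab i).2 (by omega) with h | h
        · exact .inl ⟨_, h, by simp⟩
        · exact .inr (.inr ⟨_, h, by simp⟩)
      · exact .inr (.inl ⟨-(i : ℤ), (hτm _).2 ⟨by omega, by omega⟩, by simp⟩)
  · have key : (X : ℂ[X]) • (R.fiedlerSTuple m τ).map Polynomial.C -
        (R.fiedlerSTuple m (a ++ 0 :: b)).map Polynomial.C =
        (Matrix.fromBlocks Fa 0 0 1).map Polynomial.C *
          ((X : ℂ[X]) • (Matrix.fromBlocks (R.negFiedler m ((a.map Int.natAbs).reverse ++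
            (τ.map Int.natAbs ++ (b.map Int.natAbs).reverse))) 0 0 (-R.E)).map Polynomial.C -
            (R.fiedlerS m 0).map Polynomial.C) *
          (Matrix.fromBlocks Fb 0 0 1).map Polynomial.C := by
      rw [Matrix.mul_sub, Matrix.sub_mul, Matrix.mul_smul, Matrix.smul_mul, ← Matrix.map_mul,
        ← Matrix.map_mul, ← Matrix.map_mul, ← Matrix.map_mul, fromBlocks_diag_mul,
        fromBlocks_diag_mul, negFiedler_append, negFiedler_append, ← Matrix.mul_assoc Fa, ha1,
        Matrix.one_mul, Matrix.mul_assoc, hb2, Matrix.mul_one, Matrix.one_mul, Matrix.mul_one,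
        ← hT, fiedlerSTuple_append, fiedlerSTuple_cons, ha, hb, Matrix.mul_assoc]
    rw [gfprPencil, key, e₁, e₂, e₃, e₄]
    have hP : Matrix.fromBlocks (N₁ * N₂ * Fa) 0 0 (1 : Matrix (Fin r) (Fin r) ℂ) =
        Matrix.fromBlocks N₁ 0 0 1 * Matrix.fromBlocks N₂ 0 0 1 * Matrix.fromBlocks Fa 0 0 1 := by
      simp only [fromBlocks_diag_mul, Matrix.one_mul]
    have hQ : Matrix.fromBlocks (Fb * N₃ * N₄) 0 0 (1 : Matrix (Fin r) (Fin r) ℂ) =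
        Matrix.fromBlocks Fb 0 0 1 * Matrix.fromBlocks N₃ 0 0 1 * Matrix.fromBlocks N₄ 0 0 1 := by
      simp only [fromBlocks_diag_mul, Matrix.one_mul]
    rw [hP, hQ]
    simp only [Matrix.map_mul, Matrix.mul_assoc]

end Realization

/-! ### Change of coefficient ring, and passage from block matrices to flat ones. -/

section Transport

theorem negBlock_map {S S' : Type*} [Ring S] [Ring S'] (f : S →+* S') (m i : ℕ) (W : S) :
    (negBlock m i W).map f = negBlock m i (f W) := by
  ext p q
  simp only [negBlock, Matrix.map_apply, Matrix.of_apply, apply_ite f, map_one, map_zero]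

theorem negProd_map {S S' : Type*} [Ring S] [Ring S'] (f : S →+* S') (m : ℕ) (A : ℕ → S)
    (t : List ℕ) : (negProd m A t).map f = negProd m (fun i => f (A i)) t := by
  induction t with
  | nil => simp [negProd]
  | cons i t ih => rw [negProd_cons, Matrix.map_mul, ih, negBlock_map, negProd_cons]

theorem blockDiagLast_map {S S' : Type*} [Ring S] [Ring S'] (f : S →+* S') (m : ℕ) (W : S) :
    (blockDiagLast m W).map f = blockDiagLast m (f W) := by
  ext p q
  simp only [blockDiagLast, Matrix.map_apply, Matrix.diagonal_apply, apply_ite f, map_one, map_zero]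

variable {K : Type} [CommRing K] {m n r : ℕ}

theorem comp_negProd_map {K' : Type} [CommRing K'] (f : K →+* K')
    (A : ℕ → Matrix (Fin n) (Fin n) K) (t : List ℕ) :
    (Matrix.comp _ _ _ _ _ (negProd m A t)).map f =
      Matrix.comp _ _ _ _ _ (negProd m (fun i => (A i).map f) t) :=
  (Matrix.comp_map_map _ _ _).symm.trans
    (congrArg (Matrix.comp _ _ _ _ _) (negProd_map f.mapMatrix m A t))

theorem diagLast_map {K' : Type} [CommRing K'] (f : K →+* K') (W : Matrix (Fin n) (Fin n) K) :
    (diagLast m W).map f = diagLast m (W.map f) :=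
  congrArg (Matrix.comp (Fin m) (Fin m) (Fin n) (Fin n) K')
    (blockDiagLast_map (f.mapMatrix : Matrix (Fin n) (Fin n) K →+* _) m W)

theorem comp_blockDiagLast (W : Matrix (Fin n) (Fin n) K) :
    Matrix.comp _ _ _ _ _ (blockDiagLast m W) = diagLast m W := rfl

theorem lastCol_map {K' : Type} [CommRing K'] (f : K →+* K') (M : Matrix (Fin n) (Fin r) K) :
    (lastCol m M).map f = lastCol m (M.map f) := by
  ext p q
  simp only [lastCol, Matrix.map_apply, Matrix.of_apply, apply_ite f, map_zero]

theorem lastRow_map {K' : Type} [CommRing K'] (f : K →+* K') (M : Matrix (Fin r) (Fin n) K) :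
    (lastRow m M).map f = lastRow m (M.map f) := by
  ext p q
  simp only [lastRow, Matrix.map_apply, Matrix.of_apply, apply_ite f, map_zero]

/-- A transformation that fixes the last unit block column also fixes e_m ⊗ M; this keeps the
coupling blocks of the system matrix intact. -/
theorem comp_mul_lastCol {U : Matrix (Fin (m + 1)) (Fin (m + 1)) (Matrix (Fin n) (Fin n) K)}
    (hU : Matrix.mulVec U (Pi.single (Fin.last m) 1) = Pi.single (Fin.last m) 1)
    (M : Matrix (Fin n) (Fin r) K) :
    Matrix.comp _ _ _ _ _ U * lastCol (m + 1) M = lastCol (m + 1) M := by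
  have hU' : ∀ p, U p (Fin.last m) = if p = Fin.last m then 1 else 0 := by
    intro p
    have := congrFun hU p
    simpa [Pi.single_apply] using this
  have hl : ∀ q : Fin (m + 1), (q : ℕ) + 1 = m + 1 ↔ q = Fin.last m := by
    intro q; simp [Fin.ext_iff]
  ext ⟨p, i⟩ k
  simp only [Matrix.mul_apply, lastCol, Matrix.of_apply, Fintype.sum_prod_type, Matrix.comp_apply,
    hl, mul_ite, mul_zero]
  rw [Finset.sum_eq_single (Fin.last m) (fun q _ hq => by simp [hq]) (by simp)]
  by_cases hp : p = Fin.last m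
  · simp [hU', hp, Matrix.one_apply]
  · simp [hU', hp]

theorem lastRow_mul_comp {V : Matrix (Fin (m + 1)) (Fin (m + 1)) (Matrix (Fin n) (Fin n) K)}
    (hV : Matrix.vecMul (Pi.single (Fin.last m) 1) V = Pi.single (Fin.last m) 1)
    (M : Matrix (Fin r) (Fin n) K) :
    lastRow (m + 1) M * Matrix.comp _ _ _ _ _ V = lastRow (m + 1) M := by
  have hV' : ∀ p, V (Fin.last m) p = if p = Fin.last m then 1 else 0 := by
    intro p
    have := congrFun hV p
    simpa [Pi.single_apply] using this
  have hl : ∀ q : Fin (m + 1), (q : ℕ) + 1 = m + 1 ↔ q = Fin.last m := by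
    intro q; simp [Fin.ext_iff]
  ext k ⟨p, i⟩
  simp only [Matrix.mul_apply, lastRow, Matrix.of_apply, Fintype.sum_prod_type, Matrix.comp_apply,
    hl, ite_mul, zero_mul]
  rw [Finset.sum_eq_single (Fin.last m) (fun q _ hq => by simp [hq]) (by simp)]
  by_cases hp : p = Fin.last m
  · simp [hV', hp, Matrix.one_apply]
  · simp [hV', hp]

theorem diagLast_add_lastCol_mul_lastRow (W : Matrix (Fin n) (Fin n) K)
    (M : Matrix (Fin n) (Fin r) K) (F : Matrix (Fin r) (Fin r) K) (N : Matrix (Fin r) (Fin n) K) :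
    diagLast m W + lastCol m M * F * lastRow m N = diagLast m (W + M * F * N) := by
  ext ⟨p, i⟩ ⟨q, j⟩
  by_cases hp : (p : ℕ) + 1 = m
  · by_cases hq : (q : ℕ) + 1 = m
    · obtain rfl : p = q := Fin.ext (by omega)
      simp [diagLast, lastCol, lastRow, Matrix.mul_apply, hp]
    · have hpq : p ≠ q := by rintro rfl; exact hq hp
      simp [diagLast, lastRow, Matrix.mul_apply, hq, hpq]
  · by_cases hpq : p = q
    · subst hpq
      simp [diagLast, lastCol, Matrix.mul_apply, hp]
    · simp [diagLast, lastCol, Matrix.mul_apply, hp, hpq]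

theorem diagLast_apply_last (W : Matrix (Fin n) (Fin n) K) (i j : Fin n) :
    diagLast (m + 1) W (Fin.last m, i) (Fin.last m, j) = W i j := by
  simp [diagLast]

end Transport

theorem isUnimodular_of_isUnit {ι : Type} [Fintype ι] [DecidableEq ι] {U : Matrix ι ι ℂ[X]}
    (hU : IsUnit U) : IsUnimodular U := by
  obtain ⟨c, hc, h⟩ := Polynomial.isUnit_iff.1 ((Matrix.isUnit_iff_isUnit_det U).1 hU)
  exact ⟨c, hc.ne_zero, h.symm⟩

theorem isUnit_map {ι K K' : Type*} [Fintype ι] [DecidableEq ι] [CommRing K] [CommRing K']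
    (f : K →+* K') {U : Matrix ι ι K} (hU : IsUnit U) : IsUnit (U.map f) :=
  hU.map f.mapMatrix

/-! ### The realization whose system matrix is the normalized pencil. -/

namespace Realization

variable {m n r : ℕ} (R : Realization (Fin n) r)

theorem P_eq_sum (hdeg : ∀ j, m < j → R.coeff j = 0) :
    R.P = ∑ j ∈ Finset.range (m + 1), (X : ℂ[X]) ^ j • (R.coeff j).map Polynomial.C := by
  ext1 i j
  have hd : (R.P i j).natDegree ≤ m := by
    rw [natDegree_le_iff_coeff_eq_zero]
    intro k hk
    exact congrFun (congrFun (hdeg k hk) i) j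
  rw [Matrix.sum_apply]
  conv_lhs => rw [(R.P i j).as_sum_range_C_mul_X_pow' (Nat.lt_succ_of_le hd)]
  exact Finset.sum_congr rfl fun k _ => by
    rw [Matrix.smul_apply, smul_eq_mul, mul_comm]
    rfl

/-- The realization with system matrix
`diag(P, I) (λ diag(N, -E) - 𝕄₀) diag(Q, I)`, where `N` is a product of Fiedler matrices. -/
noncomputable def fiedlerRealization (m : ℕ) (t : List ℕ)
    (P Q : Matrix (Fin m × Fin n) (Fin m × Fin n) ℂ) : Realization (Fin m × Fin n) r where
  P := P.map Polynomial.C * ((X : ℂ[X]) • (R.negFiedler m t).map Polynomial.C -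
    diagLast m ((-R.coeff 0).map Polynomial.C)) * Q.map Polynomial.C
  A := R.A
  E := R.E
  B := lastRow m R.B * Q
  C := P * lastCol m R.C
  det_E_ne_zero := R.det_E_ne_zero

variable (t : List ℕ) (P Q : Matrix (Fin m × Fin n) (Fin m × Fin n) ℂ)

theorem fiedlerRealization_P_eq_pencil :
    (R.fiedlerRealization m t P Q).P =
      (-(P * diagLast m (-R.coeff 0) * Q)).map Polynomial.C -
        (X : ℂ[X]) • (-(P * R.negFiedler m t * Q)).map Polynomial.C := by
  rw [Matrix.map_neg _ (map_neg Polynomial.C), Matrix.map_neg _ (map_neg Polynomial.C),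
    Matrix.map_mul, Matrix.map_mul, Matrix.map_mul, Matrix.map_mul, diagLast_map, smul_neg,
    sub_neg_eq_add, neg_add_eq_sub, ← Matrix.smul_mul, ← Matrix.mul_smul, ← Matrix.sub_mul,
    ← Matrix.mul_sub]
  rfl

theorem fiedlerRealization_systemMatrix :
    (R.fiedlerRealization m t P Q).systemMatrix =
      (Matrix.fromBlocks P 0 0 1).map Polynomial.C *
        ((X : ℂ[X]) • (Matrix.fromBlocks (R.negFiedler m t) 0 0 (-R.E)).map Polynomial.C -
          (R.fiedlerS m 0).map Polynomial.C) *
        (Matrix.fromBlocks Q 0 0 1).map Polynomial.C := by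
  have h0 : R.fiedlerS m 0 = Matrix.fromBlocks (diagLast m (-R.coeff 0)) (-lastCol m R.C)
      (-lastRow m R.B) (-R.A) := by
    rw [fiedlerS, if_pos rfl, fiedlerP, if_pos le_rfl, elemM, elemBlocks_zero, comp_blockDiagLast]
    rfl
  have hsub : (X : ℂ[X]) • (Matrix.fromBlocks (R.negFiedler m t) 0 0 (-R.E)).map Polynomial.C -
      (R.fiedlerS m 0).map Polynomial.C =
      Matrix.fromBlocks ((X : ℂ[X]) • (R.negFiedler m t).map Polynomial.C -
        diagLast m ((-R.coeff 0).map Polynomial.C)) ((lastCol m R.C).map Polynomial.C)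
        ((lastRow m R.B).map Polynomial.C)
        (R.A.map Polynomial.C - (X : ℂ[X]) • R.E.map Polynomial.C) := by
    rw [h0, ← diagLast_map]
    ext1 i j
    rcases i with i | i <;> rcases j with j | j <;> simp
    ring
  have h1 : (1 : Matrix (Fin r) (Fin r) ℂ).map (Polynomial.C : ℂ →+* ℂ[X]) = 1 :=
    Matrix.map_one _ (map_zero _) (map_one _)
  rw [hsub, Matrix.fromBlocks_map, Matrix.fromBlocks_map, h1,
    Matrix.map_zero _ (map_zero _), Matrix.map_zero _ (map_zero _), Matrix.fromBlocks_multiply,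
    Matrix.fromBlocks_multiply]
  simp only [Matrix.zero_mul, Matrix.mul_zero, add_zero, zero_add, Matrix.one_mul, Matrix.mul_one,
    ← Matrix.map_mul]
  rfl

theorem map_algebraMap_smul {ι κ : Type} (M : Matrix ι κ ℂ[X]) (p : ℂ[X]) :
    (p • M).map (algebraMap ℂ[X] (RatFunc ℂ)) =
      algebraMap ℂ[X] (RatFunc ℂ) p • M.map (algebraMap ℂ[X] (RatFunc ℂ)) := by
  ext i j
  simp

/-- The state-space term lives in the last diagonal block, so eliminating the states replaces A₀
there by A₀ + C(λE - A)⁻¹B. -/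
theorem fiedlerRealization_transfer :
    (R.fiedlerRealization m t P Q).transfer =
      P.map RatFunc.C * ((RatFunc.X : RatFunc ℂ) • (R.negFiedler m t).map RatFunc.C -
        diagLast m (-((R.coeff 0).map RatFunc.C + R.C.map RatFunc.C *
          ((RatFunc.X : RatFunc ℂ) • R.E.map RatFunc.C - R.A.map RatFunc.C)⁻¹ *
            R.B.map RatFunc.C))) * Q.map RatFunc.C := by
  have e := diagLast_add_lastCol_mul_lastRow (m := m) (-(R.coeff 0).map RatFunc.C)
    (-R.C.map RatFunc.C) ((RatFunc.X : RatFunc ℂ) • R.E.map RatFunc.C - R.A.map RatFunc.C)⁻¹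
    (R.B.map RatFunc.C)
  have hl : lastCol m (-R.C.map RatFunc.C) = -lastCol m (R.C.map RatFunc.C) := by
    ext p q
    simp only [lastCol, Matrix.of_apply, Matrix.neg_apply]
    split_ifs <;> simp
  rw [neg_add, ← Matrix.neg_mul, ← Matrix.neg_mul, ← e, hl, ← sub_sub, Matrix.neg_mul,
    Matrix.neg_mul, sub_neg_eq_add, Matrix.mul_add, Matrix.add_mul]
  have hP : (R.fiedlerRealization m t P Q).P.map (algebraMap ℂ[X] (RatFunc ℂ)) =
      P.map RatFunc.C * ((RatFunc.X : RatFunc ℂ) • (R.negFiedler m t).map RatFunc.C -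
        diagLast m (-(R.coeff 0).map RatFunc.C)) * Q.map RatFunc.C := by
    simp only [fiedlerRealization, Matrix.map_mul,
      Matrix.map_sub _ (map_sub (algebraMap ℂ[X] (RatFunc ℂ))), map_const, map_algebraMap_smul,
      diagLast_map, RatFunc.algebraMap_X]
    rw [Matrix.map_neg _ (map_neg RatFunc.C)]
  rw [transfer, hP]
  congr 1
  simp only [fiedlerRealization, Matrix.map_mul, lastCol_map, lastRow_map, Matrix.mul_assoc]

end Realization

/-! ### The unimodular equivalence, minimality, and the biproper equivalence. -/

namespace Realization

variable {m n r : ℕ} (R : Realization (Fin n) r)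

/-- The reduction with α = λ, preceded by P⁻¹ and followed by Q⁻¹. These cancel the factors P and Q
in the coupling blocks too, and the reduction fixes what is left of them. -/
theorem exists_unimodular_equivalence (hdeg : ∀ j, m + 1 < j → R.coeff j = 0)
    (t : List ℕ) (hn : t.Nodup) (ht : ∀ i, i ∈ t ↔ 1 ≤ i ∧ i ≤ m + 1)
    {P Q : Matrix (Fin (m + 1) × Fin n) (Fin (m + 1) × Fin n) ℂ} (hP : IsUnit P) (hQ : IsUnit Q) :
    ∃ U V : Matrix (Fin (m + 1) × Fin n) (Fin (m + 1) × Fin n) ℂ[X], IsUnit U ∧ IsUnit V ∧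
      U * (R.fiedlerRealization (m + 1) t P Q).P * V = diagLast (m + 1) R.P ∧
      U * (R.fiedlerRealization (m + 1) t P Q).C.map Polynomial.C =
        lastCol (m + 1) (R.C.map Polynomial.C) ∧
      (R.fiedlerRealization (m + 1) t P Q).B.map Polynomial.C * V =
        lastRow (m + 1) (R.B.map Polynomial.C) := by
  obtain ⟨U, V, hU, hV, hUe, hVe, hUV⟩ :=
    exists_reduction (X : ℂ[X]) m (fun j => (R.coeff j).map (Polynomial.C : ℂ →+* ℂ[X])) t hn ht
  have hred := congrArg (Matrix.comp _ _ _ _ _) (mul_blockDiagLast_mul hUe hVe _ hUV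
    ((-R.coeff 0).map (Polynomial.C : ℂ →+* ℂ[X])))
  have hsum : ∑ j ∈ Finset.range (m + 1), (X : ℂ[X]) ^ (j + 1) •
      (R.coeff (j + 1)).map (Polynomial.C : ℂ →+* ℂ[X]) -
        (-R.coeff 0).map (Polynomial.C : ℂ →+* ℂ[X]) = R.P := by
    rw [R.P_eq_sum hdeg, Finset.sum_range_succ' _ (m + 1), pow_zero, one_smul,
      Matrix.map_neg _ (map_neg _), sub_neg_eq_add]
  rw [comp_mul, comp_mul, hsum] at hred
  have hred' : Matrix.comp _ _ _ _ _ U * ((X : ℂ[X]) • (R.negFiedler (m + 1) t).map Polynomial.C -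
      diagLast (m + 1) ((-R.coeff 0).map Polynomial.C)) * Matrix.comp _ _ _ _ _ V =
      diagLast (m + 1) R.P := by
    rw [negFiedler, comp_negProd_map]
    exact hred
  have hP1 : P⁻¹.map (Polynomial.C : ℂ →+* ℂ[X]) * P.map Polynomial.C = 1 := by
    rw [← Matrix.map_mul, Matrix.nonsing_inv_mul _ ((Matrix.isUnit_iff_isUnit_det P).1 hP),
      Matrix.map_one _ (map_zero _) (map_one _)]
  have hQ1 : Q.map (Polynomial.C : ℂ →+* ℂ[X]) * Q⁻¹.map Polynomial.C = 1 := by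
    rw [← Matrix.map_mul, Matrix.mul_nonsing_inv _ ((Matrix.isUnit_iff_isUnit_det Q).1 hQ),
      Matrix.map_one _ (map_zero _) (map_one _)]
  refine ⟨Matrix.comp _ _ _ _ _ U * P⁻¹.map Polynomial.C,
    Q⁻¹.map Polynomial.C * Matrix.comp _ _ _ _ _ V,
    ((Matrix.isUnit_comp_iff _ _ _).2 hU).mul
      (isUnit_map _ (Matrix.isUnit_nonsing_inv_iff.2 hP)),
    (isUnit_map _ (Matrix.isUnit_nonsing_inv_iff.2 hQ)).mul
      ((Matrix.isUnit_comp_iff _ _ _).2 hV), ?_, ?_, ?_⟩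
  · rw [← hred']
    simp only [fiedlerRealization, Matrix.mul_assoc]
    rw [← Matrix.mul_assoc (P⁻¹.map _) (P.map _), hP1, Matrix.one_mul,
      ← Matrix.mul_assoc (Q.map _) (Q⁻¹.map _), hQ1, Matrix.one_mul]
  · rw [fiedlerRealization, Matrix.map_mul, Matrix.mul_assoc, ← Matrix.mul_assoc (P⁻¹.map _),
      hP1, Matrix.one_mul, lastCol_map, comp_mul_lastCol hUe]
  · rw [fiedlerRealization, Matrix.map_mul, Matrix.mul_assoc, ← Matrix.mul_assoc (Q.map _),
      hQ1, Matrix.one_mul, lastRow_map, lastRow_mul_comp hVe]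

theorem mul_transfer_mul_eq_diagLast {T : Realization (Fin m × Fin n) r} (hA : T.A = R.A)
    (hE : T.E = R.E) {U V : Matrix (Fin m × Fin n) (Fin m × Fin n) ℂ[X]}
    (hUPV : U * T.P * V = diagLast m R.P)
    (hUC : U * T.C.map Polynomial.C = lastCol m (R.C.map Polynomial.C))
    (hBV : T.B.map Polynomial.C * V = lastRow m (R.B.map Polynomial.C)) :
    U.map (algebraMap ℂ[X] (RatFunc ℂ)) * T.transfer * V.map (algebraMap ℂ[X] (RatFunc ℂ)) =
      diagLast m R.transfer := by
  have h1 := congrArg (fun M => M.map (algebraMap ℂ[X] (RatFunc ℂ))) hUPV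
  have h2 := congrArg (fun M => M.map (algebraMap ℂ[X] (RatFunc ℂ))) hUC
  have h3 := congrArg (fun M => M.map (algebraMap ℂ[X] (RatFunc ℂ))) hBV
  simp only [Matrix.map_mul, map_const, diagLast_map, lastCol_map, lastRow_map] at h1 h2 h3
  rw [transfer, transfer, ← diagLast_add_lastCol_mul_lastRow, ← h1, ← h2, ← h3, hA, hE]
  simp only [Matrix.mul_add, Matrix.add_mul, Matrix.mul_assoc]

/-- The last block row of U and last block column of V cut G out of the transfer function of T, so
every realization of the latter yields one of G with a pencil of the same size. -/
theorem isMinimal_of_mul_transfer_mul_eq (hmin : R.IsMinimal)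
    {T : Realization (Fin (m + 1) × Fin n) r}
    {U V : Matrix (Fin (m + 1) × Fin n) (Fin (m + 1) × Fin n) ℂ[X]}
    (h : U.map (algebraMap ℂ[X] (RatFunc ℂ)) * T.transfer *
      V.map (algebraMap ℂ[X] (RatFunc ℂ)) = diagLast (m + 1) R.transfer) : T.IsMinimal := by
  intro r' T' hT'
  obtain ⟨R', hR'⟩ := T'.exists_transfer_eq_mul (U.submatrix (fun i => (Fin.last m, i)) id)
    (V.submatrix id fun i => (Fin.last m, i))
  refine hmin r' R' ?_
  rw [hR', hT']
  ext i j
  rw [← diagLast_apply_last (m := m) R.transfer, ← h]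
  rfl

theorem smul_sum_range_eq {M : Type*} [AddCommGroup M] [Module (RatFunc ℂ) M] (A : ℕ → M) (k : ℕ) :
    ((RatFunc.X : RatFunc ℂ) ^ k)⁻¹ • ∑ j ∈ Finset.range (k + 1), (RatFunc.X : RatFunc ℂ) ^ j • A j =
      ∑ j ∈ Finset.range (k + 1), ((RatFunc.X : RatFunc ℂ)⁻¹) ^ j • A (k - j) := by
  rw [← Finset.sum_range_reflect, Finset.smul_sum]
  refine Finset.sum_congr rfl fun j hj => ?_
  have hj' : j ≤ k := Nat.lt_succ_iff.1 (Finset.mem_range.1 hj)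
  have hX : (RatFunc.X : RatFunc ℂ) ≠ 0 := RatFunc.X_ne_zero
  rw [show k + 1 - 1 - j = k - j by omega, smul_smul]
  congr 1
  rw [inv_pow, inv_mul_eq_iff_eq_mul₀ (pow_ne_zero _ hX), eq_mul_inv_iff_mul_eq₀ (pow_ne_zero _ hX),
    ← pow_add, Nat.sub_add_cancel hj']

theorem exists_biproper_equivalence (hdeg : ∀ j, m + 1 < j → R.coeff j = 0)
    (t : List ℕ) (hn : t.Nodup) (ht : ∀ i, i ∈ t ↔ 1 ≤ i ∧ i ≤ m + 1)
    {P Q : Matrix (Fin (m + 1) × Fin n) (Fin (m + 1) × Fin n) ℂ} (hP : IsUnit P) (hQ : IsUnit Q) :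
    ∃ Ol Or : Matrix (Fin (m + 1) × Fin n) (Fin (m + 1) × Fin n) (RatFunc ℂ),
      IsBiproper Ol ∧ IsBiproper Or ∧
      Ol * ((RatFunc.X : RatFunc ℂ)⁻¹ • (R.fiedlerRealization (m + 1) t P Q).transfer) * Or =
        diagLast (m + 1) (((RatFunc.X : RatFunc ℂ) ^ (m + 1))⁻¹ • R.transfer) := by
  obtain ⟨F, hF⟩ := exists_proper_resolvent R.A R.E R.det_E_ne_zero
  have hF' := Matrix.inv_eq_right_inv hF
  have hsub : ∀ {ι κ : Type} (M : Matrix ι κ ℂ),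
      (M.map properC).map properRing.subtype = M.map RatFunc.C := fun M => rfl
  -- The sign makes the final term -λ^{-(m+1)}Z of the reversed reduction equal to λ^{-(m+1)}(A₀ +
  -- C(λE - A)⁻¹B), which completes λ^{-(m+1)}G.
  set Z : Matrix (Fin n) (Fin n) properRing := -((R.coeff 0).map properC +
    R.C.map properC * F * R.B.map properC) with hZ
  obtain ⟨U, V, hU, hV, hUV⟩ := exists_reversed_reduction properInvX m
    (fun j => (R.coeff j).map properC) Z t hn ht
  set G : Matrix (Fin n) (Fin n) properRing := ∑ j ∈ Finset.range (m + 1), properInvX ^ j •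
    (R.coeff (m + 1 - j)).map properC - properInvX ^ (m + 1) • Z with hG
  have hred := congrArg (Matrix.comp _ _ _ _ _) hUV
  rw [comp_mul, comp_mul] at hred
  have hZ' : Z.map properRing.subtype = -((R.coeff 0).map RatFunc.C + R.C.map RatFunc.C *
      ((RatFunc.X : RatFunc ℂ) • R.E.map RatFunc.C - R.A.map RatFunc.C)⁻¹ *
        R.B.map RatFunc.C) := by
    rw [hZ, Matrix.map_neg _ (map_neg _), Matrix.map_add _ (map_add _), Matrix.map_mul,
      Matrix.map_mul, hsub, hsub, hsub, hF']
  have hPm : R.P.map (algebraMap ℂ[X] (RatFunc ℂ)) =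
      ∑ j ∈ Finset.range (m + 1 + 1), (RatFunc.X : RatFunc ℂ) ^ j • (R.coeff j).map RatFunc.C := by
    conv_lhs => rw [R.P_eq_sum hdeg]
    rw [← RingHom.mapMatrix_apply, map_sum]
    refine Finset.sum_congr rfl fun j _ => ?_
    rw [RingHom.mapMatrix_apply, map_algebraMap_smul, map_const, map_pow, RatFunc.algebraMap_X]
  have hsmul : ∀ {ι κ : Type} (c : properRing) (M : Matrix ι κ properRing),
      (c • M).map properRing.subtype = (c : RatFunc ℂ) • M.map properRing.subtype :=
    fun c M => rfl
  have hG' : G.map properRing.subtype =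
      ((RatFunc.X : RatFunc ℂ) ^ (m + 1))⁻¹ • R.transfer := by
    rw [transfer, smul_add, hPm, smul_sum_range_eq, Finset.sum_range_succ, hG,
      Matrix.map_sub _ (map_sub _), hsmul, hZ', ← RingHom.mapMatrix_apply, map_sum, smul_neg,
      sub_neg_eq_add, smul_add, ← add_assoc]
    have hi : ((properInvX ^ (m + 1) : properRing) : RatFunc ℂ) =
        ((RatFunc.X : RatFunc ℂ)⁻¹) ^ (m + 1) := rfl
    rw [hi, Nat.sub_self, inv_pow]
    rfl
  have hred2 := congrArg (fun M => M.map properRing.subtype) hred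
  have hred' : (Matrix.comp _ _ _ _ _ U).map properRing.subtype *
      ((R.negFiedler (m + 1) t).map RatFunc.C - (RatFunc.X : RatFunc ℂ)⁻¹ •
        diagLast (m + 1) (Z.map properRing.subtype)) *
      (Matrix.comp _ _ _ _ _ V).map properRing.subtype =
      diagLast (m + 1) (((RatFunc.X : RatFunc ℂ) ^ (m + 1))⁻¹ • R.transfer) := by
    rw [← hG', ← diagLast_map, ← diagLast_map, ← hsub, negFiedler, comp_negProd_map properC]
    simp only [Matrix.map_mul] at hred2
    exact hred2
  have hP1 : (P⁻¹.map properC).map properRing.subtype * P.map RatFunc.C = 1 := by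
    rw [hsub, ← Matrix.map_mul, Matrix.nonsing_inv_mul _ ((Matrix.isUnit_iff_isUnit_det P).1 hP),
      Matrix.map_one _ (map_zero _) (map_one _)]
  have hQ1 : Q.map RatFunc.C * (Q⁻¹.map properC).map properRing.subtype = 1 := by
    rw [hsub, ← Matrix.map_mul, Matrix.mul_nonsing_inv _ ((Matrix.isUnit_iff_isUnit_det Q).1 hQ),
      Matrix.map_one _ (map_zero _) (map_one _)]
  refine ⟨(Matrix.comp _ _ _ _ _ U * P⁻¹.map properC).map properRing.subtype,
    (Q⁻¹.map properC * Matrix.comp _ _ _ _ _ V).map properRing.subtype,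
    isBiproper_map_of_isUnit (((Matrix.isUnit_comp_iff _ _ _).2 hU).mul
      (isUnit_map _ (Matrix.isUnit_nonsing_inv_iff.2 hP))),
    isBiproper_map_of_isUnit ((isUnit_map _ (Matrix.isUnit_nonsing_inv_iff.2 hQ)).mul
      ((Matrix.isUnit_comp_iff _ _ _).2 hV)), ?_⟩
  rw [← hred', fiedlerRealization_transfer, ← hZ', Matrix.map_mul, Matrix.map_mul,
    ← Matrix.smul_mul, ← Matrix.mul_smul, smul_sub, smul_smul,
    inv_mul_cancel₀ RatFunc.X_ne_zero, one_smul]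
  simp only [Matrix.mul_assoc]
  rw [← Matrix.mul_assoc _ (P.map RatFunc.C), hP1, Matrix.one_mul,
    ← Matrix.mul_assoc (Q.map RatFunc.C), hQ1, Matrix.one_mul]

end Realization

theorem theorem3p11 {n r m : ℕ} (R : Realization (Fin n) r)
    (hdeg : ∀ j, m < j → R.coeff j = 0) (hlead : R.coeff m ≠ 0) (hmin : R.IsMinimal)
    (h : ℕ) (hm : h + 1 ≤ m)
    (σ τ σ₁ σ₂ τ₁ τ₂ : List ℤ)
    (hσ : IsPermutationOf σ 0 h) (hτ : IsPermutationOf τ (-m) (-h - 1))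
    (hσ₁ : ∀ i ∈ σ₁, 0 ≤ i ∧ i ≤ (h : ℤ) - 1) (hσ₂ : ∀ i ∈ σ₂, 0 ≤ i ∧ i ≤ (h : ℤ) - 1)
    (hσSIP : SatisfiesSIP (σ₁ ++ σ ++ σ₂))
    (hτ₁ : ∀ i ∈ τ₁, -(m : ℤ) ≤ i ∧ i ≤ -(h : ℤ) - 2)
    (hτ₂ : ∀ i ∈ τ₂, -(m : ℤ) ≤ i ∧ i ≤ -(h : ℤ) - 2)
    (hτSIP : SatisfiesSIP (τ₁ ++ τ ++ τ₂))
    (X₁ : Fin σ₁.length → Matrix (Fin n) (Fin n) ℂ)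
    (X₂ : Fin σ₂.length → Matrix (Fin n) (Fin n) ℂ)
    (Y₁ : Fin τ₁.length → Matrix (Fin n) (Fin n) ℂ)
    (Y₂ : Fin τ₂.length → Matrix (Fin n) (Fin n) ℂ)
    (hX₁ : IsNonsingularAssignment m σ₁ X₁) (hX₂ : IsNonsingularAssignment m σ₂ X₂)
    (hY₁ : IsNonsingularAssignment m τ₁ Y₁) (hY₂ : IsNonsingularAssignment m τ₂ Y₂) :
    IsRosenbrockStrongLinearization m R
      (R.gfprPencil m σ τ σ₁ σ₂ τ₁ τ₂ X₁ X₂ Y₁ Y₂) := by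
  obtain ⟨k, rfl⟩ : ∃ k, m = k + 1 := ⟨m - 1, by omega⟩
  obtain ⟨t, P, Q, hn, ht, hP, hQ, hL⟩ := R.exists_gfprPencil_eq h hm σ τ σ₁ σ₂ τ₁ τ₂ hσ hτ
    hσ₁ hσ₂ hτ₁ hτ₂ X₁ X₂ Y₁ Y₂ hX₁ hX₂ hY₁ hY₂
  rw [hL, ← R.fiedlerRealization_systemMatrix t P Q]
  obtain ⟨U, V, hU, hV, hUPV, hUC, hBV⟩ := R.exists_unimodular_equivalence hdeg t hn ht hP hQ
  refine ⟨R.fiedlerRealization (k + 1) t P Q, ⟨_, _, R.fiedlerRealization_P_eq_pencil t P Q⟩, rfl,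
    R.isMinimal_of_mul_transfer_mul_eq hmin
      (R.mul_transfer_mul_eq_diagLast rfl rfl hUPV hUC hBV),
    -- No step has acted on the state space, so U₀ and V₀ are identities.
    ⟨U, V, 1, 1, isUnimodular_of_isUnit hU, isUnimodular_of_isUnit hV, by simp, by simp, ?_⟩,
    R.exists_biproper_equivalence hdeg t hn ht hP hQ⟩
  rw [Matrix.map_one _ (map_zero _) (map_one _), Realization.systemMatrix,
    Matrix.fromBlocks_multiply, Matrix.fromBlocks_multiply]
  simp only [Matrix.zero_mul, Matrix.mul_zero, add_zero, zero_add, Matrix.one_mul, Matrix.mul_one,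
    hUPV, hUC, hBV]
  rfl
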